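/- **Two-handed assembly (2HAM).** A *glue* is a pair (label, strength), the label being a finite string and the strength a non-negative integer. A *tile type* is a unit square with a glue on each of its four sides (tiles may not be rotated). An *assembly* over a finite set $T$ of tile types is a partial function $\alpha:\mathbb Z^2\dashrightarrow T$, with domain $\operatorname{dom}\alpha$. Two tiles at adjacent positions are joined by an edge, with weight $s$, if the glues on their abutting sides are equal and have strength $s>0$; $\alpha$ is *$\tau$-stable* if every cut of the resulting graph on $\operatorname{dom}\alpha$ (partition of $\operatorname{dom}\alpha$ into two nonempty parts) has total weight at least $\tau$. The *supertile* $\tilde\alpha$ of $\alpha$ is the set of all translates of $\alpha$. The combination set $C^\tau_{\tilde\alpha,\tilde\beta}$ is the set of all supertiles of $\alpha'\cup\beta'$, where $\alpha'\in\tilde\alpha$, $\beta'\in\tilde\beta$ have disjoint domains and $\alpha'\cup\beta'$ is $\tau$-stable. A *2HAM system* is a triple $\mathcal T=(T,\sigma,\tau)$ with $T$ a finite set of tile types, $\tau\in\mathbb N$ the temperature, and $\sigma$ a set of supertiles of nonempty $\tau$-stable assemblies over $T$, the initial supertiles, each of which is available in infinitely many copies. The *finitely producible* supertiles are those obtained from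 $\sigma$ by finitely many combinations. A *growth sequence* is a finite or infinite sequence of assemblies in which each one arises from its predecessor by taking the union with a disjoint assembly such that the result is $\tau$-stable; its result is the union of its members. A supertile is *producible*, written $\in\mathcal A[\mathcal T]$, if it is the supertile of the result of a growth sequence that starts with, and successively attaches, assemblies whose supertiles are finitely producible. Write $\tilde\alpha\to_{\mathcal T}\tilde\beta$ if a growth sequence that attaches assemblies with producible supertiles leads from an element of $\tilde\alpha$ to an element of $\tilde\beta$; write $\tilde\alpha\to^1_{\mathcal T}\tilde\beta$ if $\tilde\beta\in C^\tau_{\tilde\alpha,\tilde\delta}$ for some $\tilde\delta\in\mathcal A[\mathcal T]$, and $\tilde\alpha\to^{\le1}_{\mathcal T}\tilde\beta$ if $\tilde\alpha=\tilde\beta$ or $\tilde\alpha\to^1_{\mathcal T}\tilde\beta$. **Strong simulation.** Let $\mathcal U=(U,\sigma',\tau')$ and $\mathcal T=(T,\sigma,\tau)$ be 2HAM systems and $m\ge1$. An *$m$-block* over $U$ is a partial function $\{0,\dots,m-1\}^2\dashrightarrow U$; an assembly $\alpha$ over $U$ has the blocks $\alpha^m_{x,y}(i,j)=\alpha(mx+i,my+j)$.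 A partial function $R$ from $m$-blocks over $U$ to $T$ induces the map $R^*$ with $R^*(\alpha)(x,y)=R(\alpha^m_{x,y})$, and for a supertile $\tilde\alpha$ over $U$ put $\tilde R(\tilde\alpha)=\{R^*(\alpha'):\alpha'\in\tilde\alpha,\ R^*(\alpha')\ne\emptyset\}$; $\tilde\alpha$ *represents nothing* if $\tilde R(\tilde\alpha)=\emptyset$. An assembly $\alpha$ *maps cleanly* to $R^*(\alpha)$ if either for every nonempty block $\alpha^m_{x,y}$ one of $(x,y),(x\pm1,y),(x,y\pm1)$ is in $\operatorname{dom}R^*(\alpha)$, or $\alpha$ has at most one nonempty block. A supertile $\tilde\alpha$ that represents something *maps cleanly* if $\tilde R(\tilde\alpha)$ is a supertile and every $\alpha'\in\tilde\alpha$ with $R^*(\alpha')\neq\emptyset$ maps cleanly to $R^*(\alpha')$; one that represents nothing maps cleanly if some $\alpha'\in\tilde\alpha$ has at most one nonempty block. $\mathcal U$ *strongly simulates* $\mathcal T$ at scale $m$ if for some $R$ as above: 1. (equivalent productions) $\{\tilde R(\tilde\alpha):\tilde\alpha\in\mathcal A[\mathcal U]\}\setminus\{\emptyset\}=\mathcal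 A[\mathcal T]$, and every $\tilde\alpha\in\mathcal A[\mathcal U]$ maps cleanly; 2. ($\mathcal T$ follows $\mathcal U$) if $\tilde\alpha,\tilde\beta\in\mathcal A[\mathcal U]$, $\tilde\alpha\to^1_{\mathcal U}\tilde\beta$ and $\tilde\alpha$ represents something, then $\tilde R(\tilde\alpha)\to^{\le1}_{\mathcal T}\tilde R(\tilde\beta)$; 3. ($\mathcal U$ strongly models $\mathcal T$) if $\tilde\alpha,\tilde\beta\in\mathcal A[\mathcal T]$ and $\tilde\gamma\in C^{\tau}_{\tilde\alpha,\tilde\beta}$, then for all $\tilde\alpha',\tilde\beta'\in\mathcal A[\mathcal U]$ with $\tilde R(\tilde\alpha')=\tilde\alpha$, $\tilde R(\tilde\beta')=\tilde\beta$ there are $\tilde\alpha'',\tilde\beta'',\tilde\gamma'\in\mathcal A[\mathcal U]$ with $\tilde\alpha'\to_{\mathcal U}\tilde\alpha''$, $\tilde\beta'\to_{\mathcal U}\tilde\beta''$, $\tilde R(\tilde\alpha'')=\tilde\alpha$, $\tilde R(\tilde\beta'')=\tilde\beta$, $\tilde R(\tilde\gamma')=\tilde\gamma$ and $\tilde\gamma'\in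 C^{\tau'}_{\tilde\alpha'',\tilde\beta''}$. **Theorem.** There is an absolute constant $C>0$ such that for every integer $\tau\ge2$ there is a single finite set $U_\tau$ of tile types with $|U_\tau|\le C\tau$ and the following property. For every 2HAM system $\mathcal T=(T,\sigma,\tau)$ there is a set $I_{\mathcal T}$ of supertiles over $U_\tau$ with $|I_{\mathcal T}|=|\sigma|$, consisting of finite supertiles if $\sigma$ does, such that the 2HAM system $\mathcal U_{\mathcal T}=(U_\tau,\ U_{\tau,\mathrm{sup}}\cup I_{\mathcal T},\ \tau)$, where $U_{\tau,\mathrm{sup}}$ is the set of supertiles consisting of a single tile from $U_\tau$, strongly simulates $\mathcal T$ at some scale $$m\le C\left(1+\sqrt{|G|\log|G|}\right),$$ where $G$ is the set of glues occurring on the tiles of $T$. (Thus the scale is $O(\sqrt{|G|\log|G|})$ when $|G|\ge2$, and $O(1)$ when $|G|\le1$.) -/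

import Mathlib

/-! The two-handed tile assembly model (2HAM) and (strong) simulation between 2HAM systems. -/

namespace TwoHAM

/-- The four sides of a tile. -/
inductive Dir where
  | north | east | south | west

/-- The opposite side. -/
def Dir.opp : Dir → Dir
  | .north => .south
  | .east => .west
  | .south => .north
  | .west => .east

/-- The unit vector pointing towards a side. -/
def Dir.vec : Dir → ℤ × ℤ
  | .north => (0, 1)
  | .east => (1, 0)
  | .south => (0, -1)
  | .west => (-1, 0)

/-- A glue: a label (a finite binary string) and a non-negative integer strength. -/
structure Glue where
  label : List Bool
  strength : ℕ

/-- A tile type: a unit square with a glue on each of its four sides. -/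
abbrev TileType := Dir → Glue

/-- An assembly: a partial placement of tiles on the integer lattice. -/
abbrev Assembly := ℤ × ℤ → Option TileType

/-- The set of occupied positions. -/
def dom (α : Assembly) : Set (ℤ × ℤ) := {p | α p ≠ none}

/-- The assembly uses only tiles from `T`. -/
def IsOver (T : Finset TileType) (α : Assembly) : Prop :=
  ∀ p t, α p = some t → t ∈ T

/-- The translate `α + u`. -/
def translateBy (u : ℤ × ℤ) (α : Assembly) : Assembly := fun p => α (p - u)

/-- The union of two assemblies (`α` has priority; used for disjoint assemblies). -/
def union (α β : Assembly) : Assembly := fun p => (α p).or (β p)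

/-- The assembly consisting of one tile, placed at the origin. -/
def single (t : TileType) : Assembly := fun p => if p = (0, 0) then some t else none

open Classical in
/-- The weight of the bond between position `p` and its neighbour in direction `d`: the strength
of the common glue if both positions are occupied and the abutting glues are equal, else `0`. -/
noncomputable def bond (α : Assembly) (p : ℤ × ℤ) (d : Dir) : ℕ :=
  match α p, α (p + d.vec) with
  | some t, some t' => if t d = t' d.opp then (t d).strength else 0
  | _, _ => 0

/-- `τ`-stability: every cut of the binding graph (a partition of the domain into two nonempty
parts `X` and `dom α \ X`) has weight at least `τ`. Each crossing edge is listed once, from its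
end in `X`; for infinite assemblies the weight of a cut may be infinite, so that "at least `τ`"
means that finitely many crossing edges have total weight at least `τ`. -/
def Stable (τ : ℕ) (α : Assembly) : Prop :=
  ∀ X : Set (ℤ × ℤ), X ⊆ dom α → X.Nonempty → (dom α \ X).Nonempty →
    ∃ F : Finset ((ℤ × ℤ) × Dir),
      (∀ e ∈ F, e.1 ∈ X ∧ e.1 + e.2.vec ∈ dom α \ X) ∧ τ ≤ ∑ e ∈ F, bond α e.1 e.2

/-- The supertile of `α`: the set of all its translates. -/
def supertile (α : Assembly) : Set Assembly := {β | ∃ u, β = translateBy u α}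

/-- The combination set of two supertiles at temperature `τ`. -/
def Comb (τ : ℕ) (a b : Set Assembly) : Set (Set Assembly) :=
  {c | ∃ α ∈ a, ∃ β ∈ b, Disjoint (dom α) (dom β) ∧ Stable τ (union α β) ∧
    c = supertile (union α β)}

/-- A 2HAM system: a finite tile set, a set of initial supertiles, each present in infinitely
many copies, and a temperature. The initial supertiles are supertiles of nonempty
assemblies over the tile set which are stable at the given temperature. -/
structure System where
  tiles : Finset TileType
  init : Set (Set Assembly)
  temp : ℕ
  init_spec : ∀ s ∈ init, ∃ α, s = supertile α ∧ IsOver tiles α ∧ (dom α).Nonempty ∧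
    Stable temp α

/-- The supertiles that occur in the states of assembly sequences starting from the initial
state. As all counts are infinite these are the supertiles obtained from the initial
ones by finitely many combinations. -/
inductive FinProducible (S : System) : Set Assembly → Prop
  | init (s : Set Assembly) : s ∈ S.init → FinProducible S s
  | comb (a b c : Set Assembly) : FinProducible S a → FinProducible S b →
      c ∈ Comb S.temp a b → FinProducible S c

/-- `β` arises from `α` by stable attachment of a disjoint assembly whose supertile is in `P`. -/
def Attach (τ : ℕ) (P : Set (Set Assembly)) (α β : Assembly) : Prop :=
  ∃ δ, supertile δ ∈ P ∧ Disjoint (dom α) (dom δ) ∧ β = union α δ ∧ Stable τ β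

/-- `f` is a (finite or infinite) sequence of successive attachments of supertiles from `P`, with
idle steps allowed (a finite sequence is one that is eventually idle), and `γ` is its result. -/
def GrowsTo (τ : ℕ) (P : Set (Set Assembly)) (f : ℕ → Assembly) (γ : Assembly) : Prop :=
  (∀ i, f (i + 1) = f i ∨ Attach τ P (f i) (f (i + 1))) ∧
    ∀ p t, γ p = some t ↔ ∃ i, f i p = some t

/-- The producible supertiles: the results of finite and infinite sequences of attachments. -/
def Producible (S : System) : Set (Set Assembly) :=
  {c | ∃ f γ, FinProducible S (supertile (f 0)) ∧
    GrowsTo S.temp {s | FinProducible S s} f γ ∧ c = supertile γ}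

/-- `a →¹ b`: one attachment of a producible supertile leads from `a` to `b`. -/
def Step (S : System) (a b : Set Assembly) : Prop :=
  ∃ d ∈ Producible S, b ∈ Comb S.temp a d

/-- `a → b`: a finite or infinite sequence of attachments of producible supertiles leads from `a`
to `b`. -/
def Leads (S : System) (a b : Set Assembly) : Prop :=
  ∃ f γ, f 0 ∈ a ∧ GrowsTo S.temp (Producible S) f γ ∧ b = supertile γ

/-- An `m`-block: a partial placement of tiles on an `m × m` square. -/
abbrev Block (m : ℕ) := Fin m → Fin m → Option TileType

/-- The `m`-block of `α` at block coordinates `q`. -/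
def block (m : ℕ) (α : Assembly) (q : ℤ × ℤ) : Block m :=
  fun i j => α ((m : ℤ) * q.1 + (i : ℕ), (m : ℤ) * q.2 + (j : ℕ))

/-- The `m`-block of `α` at block coordinates `q` contains a tile. -/
def BlockNonempty (m : ℕ) (α : Assembly) (q : ℤ × ℤ) : Prop :=
  ∃ i j, block m α q i j ≠ none

/-- The assembly representation function `R*` of a partial function `R` from blocks to tiles. -/
def repAssembly {m : ℕ} (R : Block m → Option TileType) (α : Assembly) : Assembly :=
  fun q => R (block m α q)

/-- The supertile representation function: the set of all nonempty assemblies `R*(α)` with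
`α` in the supertile `a`. Translates of `α` that are not aligned with the grid of `m`-blocks and
represent nothing do not count; the value is empty if `a` does not represent anything. -/
def repSupertile {m : ℕ} (R : Block m → Option TileType) (a : Set Assembly) : Set Assembly :=
  {β | (dom β).Nonempty ∧ ∃ α ∈ a, repAssembly R α = β}

/-- At most one `m`-block of `α` is nonempty. -/
def AtMostOneBlock (m : ℕ) (α : Assembly) : Prop :=
  ∀ q q', BlockNonempty m α q → BlockNonempty m α q' → q = q'

/-- `α` maps cleanly to `β`: every nonempty block is at, or directly north, south, east or west
of, a position of `β`; or there is at most one nonempty block. -/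
def CleanAssembly (m : ℕ) (α β : Assembly) : Prop :=
  (∀ q, BlockNonempty m α q → ∃ u v : ℤ, u ^ 2 + v ^ 2 < 2 ∧ q + (u, v) ∈ dom β) ∨
    AtMostOneBlock m α

/-- The supertile `a` maps cleanly under `R`: what it represents is one supertile, and every
element of `a` that represents something maps cleanly; if `a` represents nothing, then it can be
positioned within one block. -/
def CleanSupertile {m : ℕ} (R : Block m → Option TileType) (a : Set Assembly) : Prop :=
  ((repSupertile R a).Nonempty → (∃ β, repSupertile R a = supertile β) ∧
    ∀ α ∈ a, (dom (repAssembly R α)).Nonempty → CleanAssembly m α (repAssembly R α)) ∧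
  (repSupertile R a = ∅ → ∃ α ∈ a, AtMostOneBlock m α)

/-- `U` and `T` have equivalent productions under `R`. -/
def EquivProductions {m : ℕ} (U T : System) (R : Block m → Option TileType) : Prop :=
  (repSupertile R '' Producible U) \ {∅} = Producible T ∧
    ∀ a ∈ Producible U, CleanSupertile R a

/-- `T` follows `U` under `R`. -/
def Follows {m : ℕ} (T U : System) (R : Block m → Option TileType) : Prop :=
  ∀ a ∈ Producible U, ∀ b ∈ Producible U, Step U a b → (repSupertile R a).Nonempty →
    repSupertile R a = repSupertile R b ∨ Step T (repSupertile R a) (repSupertile R b)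

/-- `U` strongly models `T` under `R`. -/
def StronglyModels {m : ℕ} (U T : System) (R : Block m → Option TileType) : Prop :=
  ∀ a ∈ Producible T, ∀ b ∈ Producible T, ∀ c ∈ Comb T.temp a b,
    ∀ a' ∈ Producible U, ∀ b' ∈ Producible U, repSupertile R a' = a → repSupertile R b' = b →
      ∃ a'' ∈ Producible U, ∃ b'' ∈ Producible U, ∃ c' ∈ Producible U,
        Leads U a' a'' ∧ Leads U b' b'' ∧ repSupertile R a'' = a ∧ repSupertile R b'' = b ∧
          repSupertile R c' = c ∧ c' ∈ Comb U.temp a'' b''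

/-- `U` strongly simulates `T` at scale factor `m`. -/
def StronglySimulates (U T : System) (m : ℕ) : Prop :=
  1 ≤ m ∧ ∃ R : Block m → Option TileType, (∀ B t, R B = some t → t ∈ T.tiles) ∧
    EquivProductions U T R ∧ Follows T U R ∧ StronglyModels U T R

/-- The set of supertiles that consist of one tile of `T`. -/
def singletonSupertiles (T : Finset TileType) : Set (Set Assembly) :=
  {s | ∃ t ∈ T, s = supertile (single t)}

/-- The set of glues on the sides of the tiles of `T` (a finite set). -/
def glues (T : Finset TileType) : Set Glue := {g | ∃ t ∈ T, ∃ d : Dir, t d = g}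

/-- All assemblies in `s` are finite. -/
def FiniteSupertile (s : Set Assembly) : Prop := ∀ α ∈ s, (dom α).Finite

end TwoHAM

/-! Every tile of `T` is replaced by a macrotile, a fixed shape on the scale `m = 12a` with `a =
⌊√|G|⌋ + 2`: a square in which combs are cut out of the west and south sides and added to the east
and north sides, so that copies at the points of `m ℤ²` interlock. The label of a glue is encoded by
geometry. Glues are indexed by pairs `(i, j)` with `i, j < a`; on the east side, glue `(i, j)` sits
on top of arm `i` at columns `2j` and `2j + 1`, and it faces the corresponding two cells beside a
notch of the eastern neighbour. If two macrotiles touch at sites with different indices, they are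
displaced from lattice position by `(2(j - j'), 4(i - i'))`. Arms alone could still slide into other
notches, but the hook on the last arm then collides with the other macrotile (`exists_overlap`).
Hence a positive bond between disjoint macrotiles forces lattice position and equal glues
(`macroTile_contact`). Using both coordinates of the arms accommodates `a²` glues at scale `O(a)`,
so the logarithm in the bound is not even needed.

A strength `s` enters only as `min s τ`, which does not affect whether a cut reaches `τ`, and it is
split into two halves of strength less than `τ`. Within a macrotile all neighbours are bound with
strength `(τ + 1) / 2`, and since the shape is a connected union of 2×2 squares every cut of it
crosses at least two edges. Therefore an assembly over `T` is stable exactly if its expansion is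
(`stable_expand`, `stable_of_expand`).

The available single tiles are harmless: all glues are weaker than `τ`, and a single tile meets the
exterior of a macrotile with a positive bond on at most one side (`Inert`). So the producible
supertiles of the simulator are the single tiles and the expansions of producible supertiles of `T`
(`producible_cases`, `producible_expand`), and combinations correspond on both sides, which gives
all three conditions of strong simulation.

The tile set is small because inner labels carry five bits instead of coordinates: one bit marks the
origin of the macrotile, which fixes the alignment of blocks, and four mark the indices of its
glues, which makes it decodable. At most one side of a tile carries one of the at most `2(τ + 1)`
bonding glues, hence `O(τ)` tiles. -/

namespace TwoHAM

/-! ### Basic facts on assemblies, bonds and stability -/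

theorem Dir.opp_opp (d : Dir) : d.opp.opp = d := by cases d <;> rfl

theorem Dir.opp_vec (d : Dir) : d.opp.vec = -d.vec := by cases d <;> rfl

theorem mem_dom {α : Assembly} {p : ℤ × ℤ} : p ∈ dom α ↔ ∃ t, α p = some t := by
  simp [dom, Option.ne_none_iff_exists']

theorem notMem_dom {α : Assembly} {p : ℤ × ℤ} : p ∉ dom α ↔ α p = none := by
  simp [dom]

theorem bond_some {α : Assembly} {p : ℤ × ℤ} {d : Dir} {t t' : TileType}
    (h : α p = some t) (h' : α (p + d.vec) = some t') (hg : t d = t' d.opp) :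
    bond α p d = (t d).strength := by
  simp [bond, h, h', hg]

theorem bond_pos {α : Assembly} {p : ℤ × ℤ} {d : Dir} (h : 0 < bond α p d) :
    ∃ t t', α p = some t ∧ α (p + d.vec) = some t' ∧ t d = t' d.opp ∧
      bond α p d = (t d).strength := by
  unfold bond at h ⊢
  split at h
  · rename_i t t' h1 h2
    split_ifs at h with h3
    · exact ⟨t, t', h1, h2, h3, by simp [h3]⟩
    · simp at h
  · simp at h

theorem bond_opp (α : Assembly) (p : ℤ × ℤ) (d : Dir) :
    bond α (p + d.vec) d.opp = bond α p d := by
  have h : p + d.vec + d.opp.vec = p := by rw [Dir.opp_vec]; abel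
  unfold bond
  rw [h]
  cases h1 : α p with
  | none => cases h2 : α (p + d.vec) <;> simp
  | some t =>
    cases h2 : α (p + d.vec) with
    | none => simp
    | some t' =>
      simp only [Dir.opp_opp]
      by_cases h3 : t d = t' d.opp
      · simp [h3, Dir.opp_opp]
      · have : ¬ t' d.opp = t d := fun h => h3 h.symm
        simp [h3, this, Dir.opp_opp]

theorem bond_mono {α β : Assembly} (h : ∀ p t, α p = some t → β p = some t) (p : ℤ × ℤ) (d : Dir) :
    bond α p d ≤ bond β p d := by
  rcases Nat.eq_zero_or_pos (bond α p d) with h0 | h0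
  · omega
  · obtain ⟨t, t', h1, h2, h3, h4⟩ := bond_pos h0
    rw [h4, bond_some (h _ _ h1) (h _ _ h2) h3]

theorem union_some {α β : Assembly} (hd : Disjoint (dom α) (dom β)) {p : ℤ × ℤ} {t : TileType} :
    union α β p = some t ↔ α p = some t ∨ β p = some t := by
  unfold union
  cases h : α p with
  | none => simp
  | some s =>
    have : p ∉ dom β := Set.disjoint_left.1 hd (mem_dom.2 ⟨s, h⟩)
    rw [notMem_dom] at this
    simp [this]

theorem assembly_ext {α β : Assembly} (h : ∀ p t, α p = some t ↔ β p = some t) : α = β := by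
  funext p
  exact Option.ext (h p)

theorem union_comm_of_disjoint {α β : Assembly} (hd : Disjoint (dom α) (dom β)) :
    union α β = union β α :=
  assembly_ext fun p t => by rw [union_some hd, union_some hd.symm, or_comm]

theorem dom_union (α β : Assembly) : dom (union α β) = dom α ∪ dom β := by
  ext p
  simp only [dom, union, Set.mem_ofPred_eq, Set.mem_union]
  cases α p <;> simp

theorem union_assoc' (α β γ : Assembly) : union (union α β) γ = union α (union β γ) := by
  funext p
  simp [union, Option.or_assoc]

@[simp] theorem translateBy_apply (u : ℤ × ℤ) (α : Assembly) (p : ℤ × ℤ) :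
    translateBy u α p = α (p - u) := rfl

@[simp] theorem translateBy_zero (α : Assembly) : translateBy 0 α = α := by
  funext p; simp

theorem translateBy_translateBy (u v : ℤ × ℤ) (α : Assembly) :
    translateBy u (translateBy v α) = translateBy (u + v) α := by
  funext p; simp [sub_sub]

theorem translateBy_union (u : ℤ × ℤ) (α β : Assembly) :
    translateBy u (union α β) = union (translateBy u α) (translateBy u β) := rfl

theorem mem_dom_translateBy {u : ℤ × ℤ} {α : Assembly} {p : ℤ × ℤ} :
    p ∈ dom (translateBy u α) ↔ p - u ∈ dom α := Iff.rfl

theorem dom_translateBy_disjoint {u : ℤ × ℤ} {α β : Assembly} :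
    Disjoint (dom (translateBy u α)) (dom (translateBy u β)) ↔ Disjoint (dom α) (dom β) := by
  simp only [Set.disjoint_left, mem_dom_translateBy]
  refine ⟨fun h p hp => ?_, fun h p hp => h hp⟩
  have := @h (p + u)
  simp only [add_sub_cancel_right] at this
  exact this hp

theorem dom_translateBy_nonempty {u : ℤ × ℤ} {α : Assembly} :
    (dom (translateBy u α)).Nonempty ↔ (dom α).Nonempty :=
  ⟨fun ⟨p, hp⟩ => ⟨p - u, hp⟩, fun ⟨p, hp⟩ => ⟨p + u, by simpa [mem_dom_translateBy] using hp⟩⟩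

theorem isOver_translateBy {T : Finset TileType} {u : ℤ × ℤ} {α : Assembly} (h : IsOver T α) :
    IsOver T (translateBy u α) := fun p t hp => h (p - u) t hp

theorem isOver_union {T : Finset TileType} {α β : Assembly} (h : IsOver T α) (h' : IsOver T β) :
    IsOver T (union α β) := by
  intro p t hp
  simp only [union, Option.or_eq_some_iff] at hp
  rcases hp with hp | hp
  · exact h p t hp
  · exact h' p t hp.2

theorem bond_translateBy (u : ℤ × ℤ) (α : Assembly) (p : ℤ × ℤ) (d : Dir) :
    bond (translateBy u α) p d = bond α (p - u) d := by
  have : p + d.vec - u = p - u + d.vec := by abel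
  simp only [bond, translateBy_apply, this]

theorem Stable.translateBy {τ : ℕ} {α : Assembly} (h : Stable τ α) (u : ℤ × ℤ) :
    Stable τ (translateBy u α) := by
  classical
  intro X hX ⟨x, hx⟩ ⟨y, hy, hyX⟩
  obtain ⟨F, hF, hs⟩ := h ((fun p => p + u) ⁻¹' X)
    (fun p hp => by simpa [mem_dom_translateBy] using hX hp)
    ⟨x - u, by simpa using hx⟩ ⟨y - u, hy, by simpa using hyX⟩
  have hinj : Function.Injective fun e : (ℤ × ℤ) × Dir => (e.1 + u, e.2) := by
    intro e e' h
    simp only [Prod.mk.injEq, add_left_inj] at h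
    exact Prod.ext h.1 h.2
  refine ⟨F.image fun e => (e.1 + u, e.2), ?_, ?_⟩
  · intro e he
    obtain ⟨e', he', rfl⟩ := Finset.mem_image.1 he
    obtain ⟨h1, h2, h3⟩ := hF e' he'
    have : e'.1 + u + e'.2.vec = e'.1 + e'.2.vec + u := by abel
    refine ⟨h1, ?_, ?_⟩
    · simp only [mem_dom_translateBy, this, add_sub_cancel_right]
      exact h2
    · rw [this]; exact h3
  · rw [Finset.sum_image hinj.injOn]
    simpa [bond_translateBy] using hs

theorem stable_translateBy {τ : ℕ} {α : Assembly} {u : ℤ × ℤ} :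
    Stable τ (translateBy u α) ↔ Stable τ α :=
  ⟨fun h => by simpa [translateBy_translateBy] using h.translateBy (-u), fun h => h.translateBy u⟩

theorem self_mem_supertile (α : Assembly) : α ∈ supertile α := ⟨0, by simp⟩

theorem supertile_translateBy (u : ℤ × ℤ) (α : Assembly) :
    supertile (translateBy u α) = supertile α := by
  ext β
  constructor
  · rintro ⟨v, rfl⟩
    exact ⟨v + u, translateBy_translateBy _ _ _⟩
  · rintro ⟨v, rfl⟩
    exact ⟨v - u, by simp [translateBy_translateBy]⟩

theorem eq_translateBy_of_supertile_eq {α β : Assembly} (h : supertile α = supertile β) :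
    ∃ u, α = translateBy u β := by
  have := self_mem_supertile α
  rw [h] at this
  exact this

/-- Two stable assemblies joined by bonds of sufficient total weight form a stable assembly. -/
theorem stable_union {τ : ℕ} {α β : Assembly} (hα : Stable τ α) (hβ : Stable τ β)
    (hd : Disjoint (dom α) (dom β)) (F : Finset ((ℤ × ℤ) × Dir))
    (hF : ∀ e ∈ F, e.1 ∈ dom α ∧ e.1 + e.2.vec ∈ dom β)
    (hs : τ ≤ ∑ e ∈ F, bond (union α β) e.1 e.2) : Stable τ (union α β) := by
  classical
  have hml : ∀ p t, α p = some t → union α β p = some t :=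
    fun p t h => (union_some hd).2 (Or.inl h)
  have hmr : ∀ p t, β p = some t → union α β p = some t :=
    fun p t h => (union_some hd).2 (Or.inr h)
  have key : ∀ γ : Assembly, Stable τ γ → (∀ p t, γ p = some t → union α β p = some t) →
      ∀ X : Set (ℤ × ℤ), (∃ x ∈ dom γ, x ∈ X) → (∃ y ∈ dom γ, y ∉ X) →
      ∃ F : Finset ((ℤ × ℤ) × Dir), (∀ e ∈ F, e.1 ∈ X ∧ e.1 + e.2.vec ∈ dom (union α β) \ X) ∧
        τ ≤ ∑ e ∈ F, bond (union α β) e.1 e.2 := by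
    rintro γ hγ hm X ⟨x, hx, hxX⟩ ⟨y, hy, hyX⟩
    obtain ⟨F, h1, h2⟩ := hγ (X ∩ dom γ) Set.inter_subset_right ⟨x, hxX, hx⟩
      ⟨y, hy, fun h => hyX h.1⟩
    refine ⟨F, fun e he => ?_, h2.trans (Finset.sum_le_sum fun e _ => bond_mono hm _ _)⟩
    obtain ⟨⟨h3, h4⟩, h5, h6⟩ := h1 e he
    refine ⟨h3, ?_, fun h => h6 ⟨h, h5⟩⟩
    obtain ⟨t, ht⟩ := mem_dom.1 h5
    exact mem_dom.2 ⟨t, hm _ _ ht⟩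
  intro X hX ⟨x, hx⟩ ⟨y, hy, hyX⟩
  by_cases h1 : (∃ x ∈ dom α, x ∈ X) ∧ (∃ y ∈ dom α, y ∉ X)
  · exact key α hα hml X h1.1 h1.2
  by_cases h2 : (∃ x ∈ dom β, x ∈ X) ∧ (∃ y ∈ dom β, y ∉ X)
  · exact key β hβ hmr X h2.1 h2.2
  rw [dom_union] at hX hy ⊢
  rcases hX hx with hxα | hxβ
  · have hαX : ∀ z ∈ dom α, z ∈ X := by
      intro z hz; by_contra hzX; exact h1 ⟨⟨x, hxα, hx⟩, ⟨z, hz, hzX⟩⟩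
    have hyβ : y ∈ dom β := hy.resolve_left fun h => hyX (hαX y h)
    have hβX : ∀ z ∈ dom β, z ∉ X := by
      intro z hz hzX; exact h2 ⟨⟨z, hz, hzX⟩, ⟨y, hyβ, hyX⟩⟩
    exact ⟨F, fun e he => ⟨hαX _ (hF e he).1, Or.inr (hF e he).2, hβX _ (hF e he).2⟩, hs⟩
  · have hβX : ∀ z ∈ dom β, z ∈ X := by
      intro z hz; by_contra hzX; exact h2 ⟨⟨x, hxβ, hx⟩, ⟨z, hz, hzX⟩⟩
    have hyα : y ∈ dom α := hy.resolve_right fun h => hyX (hβX y h)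
    have hαX : ∀ z ∈ dom α, z ∉ X := by
      intro z hz hzX; exact h1 ⟨⟨z, hz, hzX⟩, ⟨y, hyα, hyX⟩⟩
    have hrev : ∀ e : (ℤ × ℤ) × Dir, e.1 + e.2.vec + e.2.opp.vec = e.1 := by
      intro e; rw [Dir.opp_vec]; abel
    have hinj : Function.Injective fun e : (ℤ × ℤ) × Dir => (e.1 + e.2.vec, e.2.opp) := by
      intro e e' h
      simp only [Prod.mk.injEq] at h
      have h2 : e.2 = e'.2 := by rw [← Dir.opp_opp e.2, h.2, Dir.opp_opp]
      have h1 := h.1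
      rw [h2, add_left_inj] at h1
      exact Prod.ext h1 h2
    refine ⟨F.image fun e => (e.1 + e.2.vec, e.2.opp), ?_, ?_⟩
    · intro e he
      obtain ⟨e', he', rfl⟩ := Finset.mem_image.1 he
      obtain ⟨h3, h4⟩ := hF e' he'
      simp only [hrev]
      exact ⟨hβX _ h4, Or.inl h3, hαX _ h3⟩
    · rw [Finset.sum_image hinj.injOn]
      simpa [bond_opp] using hs

theorem exists_bonds_of_stable_union {τ : ℕ} {α β : Assembly} (hd : Disjoint (dom α) (dom β))
    (hα : (dom α).Nonempty) (hβ : (dom β).Nonempty) (h : Stable τ (union α β)) :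
    ∃ F : Finset ((ℤ × ℤ) × Dir), (∀ e ∈ F, e.1 ∈ dom α ∧ e.1 + e.2.vec ∈ dom β) ∧
      τ ≤ ∑ e ∈ F, bond (union α β) e.1 e.2 := by
  obtain ⟨y, hy⟩ := hβ
  have := h (dom α) (by rw [dom_union]; exact Set.subset_union_left) hα
    ⟨y, by rw [dom_union]; exact Or.inr hy, Set.disjoint_right.1 hd hy⟩
  obtain ⟨F, hF, hs⟩ := this
  refine ⟨F, fun e he => ⟨(hF e he).1, ?_⟩, hs⟩
  have := (hF e he).2
  rw [dom_union] at this
  exact this.1.resolve_left this.2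

/-! ### Producible supertiles -/

/-- Nonempty stable assemblies over the tile set of a system. -/
def Sound (S : System) (α : Assembly) : Prop :=
  IsOver S.tiles α ∧ (dom α).Nonempty ∧ Stable S.temp α

theorem Sound.translateBy {S : System} {α : Assembly} (h : Sound S α) (u : ℤ × ℤ) :
    Sound S (translateBy u α) :=
  ⟨isOver_translateBy h.1, dom_translateBy_nonempty.2 h.2.1, h.2.2.translateBy u⟩

theorem FinProducible.sound {S : System} {s : Set Assembly} (h : FinProducible S s) :
    ∀ α ∈ s, Sound S α := by
  induction h with
  | init s hs =>
    obtain ⟨α, rfl, h⟩ := S.init_spec s hs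
    rintro _ ⟨u, rfl⟩
    exact Sound.translateBy h u
  | comb a b c _ _ hc iha ihb =>
    obtain ⟨α, hα, β, hβ, _, hst, rfl⟩ := hc
    rintro _ ⟨u, rfl⟩
    refine Sound.translateBy ⟨isOver_union (iha α hα).1 (ihb β hβ).1, ?_, hst⟩ u
    rw [dom_union]
    exact (iha α hα).2.1.inl

theorem FinProducible.eq_supertile {S : System} {s : Set Assembly} (h : FinProducible S s) :
    ∃ α, s = supertile α := by
  cases h with
  | init s hs =>
    obtain ⟨α, rfl, _⟩ := S.init_spec s hs
    exact ⟨α, rfl⟩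
  | comb a b c _ _ hc =>
    obtain ⟨α, _, β, _, _, _, rfl⟩ := hc
    exact ⟨_, rfl⟩

theorem FinProducible.attach {S : System} {α β : Assembly} (h : FinProducible S (supertile α))
    (hs : Attach S.temp {s | FinProducible S s} α β) : FinProducible S (supertile β) := by
  obtain ⟨δ, hδ, hd, rfl, hst⟩ := hs
  exact FinProducible.comb _ _ _ h hδ ⟨α, self_mem_supertile _, δ, self_mem_supertile _, hd, hst, rfl⟩

theorem finProducible_growth {S : System} {f : ℕ → Assembly} {γ : Assembly}
    (h0 : FinProducible S (supertile (f 0)))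
    (hf : GrowsTo S.temp {s | FinProducible S s} f γ) (i : ℕ) :
    FinProducible S (supertile (f i)) := by
  induction i with
  | zero => exact h0
  | succ i ih =>
    rcases hf.1 i with h | h
    · rwa [h]
    · exact ih.attach h

theorem growth_mono {τ : ℕ} {Q : Set (Set Assembly)} {f : ℕ → Assembly} {γ : Assembly}
    (hf : GrowsTo τ Q f γ) {i j : ℕ} (hij : i ≤ j) {p : ℤ × ℤ} {t : TileType}
    (h : f i p = some t) : f j p = some t := by
  induction j, hij using Nat.le_induction with
  | base => exact h
  | succ j _ ih =>
    rcases hf.1 j with h | ⟨δ, _, hd, h, _⟩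
    · rwa [h]
    · rw [h, union_some hd]; exact Or.inl ih

theorem FinProducible.producible {S : System} {s : Set Assembly} (h : FinProducible S s) :
    s ∈ Producible S := by
  obtain ⟨α, rfl⟩ := h.eq_supertile
  exact ⟨fun _ => α, α, h, ⟨fun _ => Or.inl rfl, fun p t => by simp⟩, rfl⟩

theorem leads_refl (S : System) (α : Assembly) : Leads S (supertile α) (supertile α) :=
  ⟨fun _ => α, α, self_mem_supertile α, ⟨fun _ => Or.inl rfl, fun p t => by simp⟩, rfl⟩

/-- The result of a growth sequence that starts with a producible supertile is stable. -/
theorem stable_of_growth {S : System} {f : ℕ → Assembly} {γ : Assembly}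
    (h0 : FinProducible S (supertile (f 0)))
    (hf : GrowsTo S.temp {s | FinProducible S s} f γ) : Sound S γ := by
  have hs : ∀ i, Sound S (f i) := fun i =>
    (finProducible_growth h0 hf i).sound _ (self_mem_supertile _)
  refine ⟨fun p t h => ?_, ?_, ?_⟩
  · obtain ⟨i, hi⟩ := (hf.2 p t).1 h
    exact (hs i).1 p t hi
  · obtain ⟨p, hp⟩ := (hs 0).2.1
    obtain ⟨t, ht⟩ := mem_dom.1 hp
    exact ⟨p, mem_dom.2 ⟨t, (hf.2 p t).2 ⟨0, ht⟩⟩⟩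
  · intro X hX ⟨x, hx⟩ ⟨y, hy, hyX⟩
    obtain ⟨t, ht⟩ := mem_dom.1 (hX hx)
    obtain ⟨t', ht'⟩ := mem_dom.1 hy
    obtain ⟨i, hi⟩ := (hf.2 _ _).1 ht
    obtain ⟨j, hj⟩ := (hf.2 _ _).1 ht'
    have hi := growth_mono hf (le_max_left i j) hi
    have hj := growth_mono hf (le_max_right i j) hj
    set k := max i j
    have hsub : ∀ p t, f k p = some t → γ p = some t := fun p t h => (hf.2 p t).2 ⟨k, h⟩
    -- Stage `k` already meets both sides of the cut, so the cut induced on `f k` has weight `τ`,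
    -- and bonds persist under growth.
    obtain ⟨F, hF, hsum⟩ := (hs k).2.2 (X ∩ dom (f k)) Set.inter_subset_right
      ⟨x, hx, mem_dom.2 ⟨_, hi⟩⟩ ⟨y, mem_dom.2 ⟨_, hj⟩, fun h => hyX h.1⟩
    refine ⟨F, fun e he => ?_, hsum.trans (Finset.sum_le_sum fun e _ => bond_mono hsub _ _)⟩
    obtain ⟨⟨h3, h4⟩, h5, h6⟩ := hF e he
    refine ⟨h3, ?_, fun h => h6 ⟨h, h5⟩⟩
    obtain ⟨t, ht⟩ := mem_dom.1 h5
    exact mem_dom.2 ⟨t, hsub _ _ ht⟩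

theorem producible_spec {S : System} {c : Set Assembly} (h : c ∈ Producible S) :
    ∃ α, c = supertile α ∧ Sound S α := by
  obtain ⟨f, γ, h0, hf, rfl⟩ := h
  exact ⟨γ, rfl, stable_of_growth h0 hf⟩

theorem GrowsTo.translateBy {τ : ℕ} {Q : Set (Set Assembly)} {f : ℕ → Assembly} {γ : Assembly}
    (hf : GrowsTo τ Q f γ) (u : ℤ × ℤ) :
    GrowsTo τ Q (fun i => translateBy u (f i)) (translateBy u γ) := by
  refine ⟨fun i => ?_, fun p t => hf.2 _ t⟩
  rcases hf.1 i with h | ⟨δ, hδ, hd, h, hst⟩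
  · exact Or.inl (by simp only [h])
  · refine Or.inr ⟨TwoHAM.translateBy u δ, by rwa [supertile_translateBy],
      dom_translateBy_disjoint.2 hd, ?_, hst.translateBy u⟩
    simp only [h, translateBy_union]

theorem exists_growth_of_mem {S : System} {a : Set Assembly} (ha : a ∈ Producible S)
    {α : Assembly} (hα : α ∈ a) : ∃ f, FinProducible S (supertile (f 0)) ∧
      GrowsTo S.temp {s | FinProducible S s} f α := by
  obtain ⟨f, γ, h0, hf, rfl⟩ := ha
  obtain ⟨u, rfl⟩ := hα
  exact ⟨_, by simpa [supertile_translateBy] using h0, hf.translateBy u⟩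

/-- The combination of two producible supertiles is producible. -/
theorem comb_producible {S : System} {a b c : Set Assembly}
    (ha : a ∈ Producible S) (hb : b ∈ Producible S) (hc : c ∈ Comb S.temp a b) :
    c ∈ Producible S := by
  obtain ⟨α, hα, β, hβ, hd, hst, rfl⟩ := hc
  obtain ⟨f, f0, hf⟩ := exists_growth_of_mem ha hα
  obtain ⟨g, g0, hg⟩ := exists_growth_of_mem hb hβ
  have hfin := finProducible_growth f0 hf
  have hgin := finProducible_growth g0 hg
  have hfs : ∀ i, Sound S (f i) := fun i => (hfin i).sound _ (self_mem_supertile _)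
  have hgs : ∀ i, Sound S (g i) := fun i => (hgin i).sound _ (self_mem_supertile _)
  have hfα : ∀ i p t, f i p = some t → α p = some t := fun i p t h => (hf.2 p t).2 ⟨i, h⟩
  have hgβ : ∀ i p t, g i p = some t → β p = some t := fun i p t h => (hg.2 p t).2 ⟨i, h⟩
  have hdom : ∀ {γ δ : Assembly}, (∀ p t, γ p = some t → δ p = some t) → dom γ ⊆ dom δ := by
    intro γ δ h p hp
    obtain ⟨t, ht⟩ := mem_dom.1 hp
    exact mem_dom.2 ⟨t, h _ _ ht⟩
  have hdis : ∀ i j, Disjoint (dom (f i)) (dom (g j)) := fun i j =>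
    hd.mono (hdom (hfα i)) (hdom (hgβ j))
  obtain ⟨F, hF, hsum⟩ := exists_bonds_of_stable_union hd
    (stable_of_growth f0 hf).2.1 (stable_of_growth g0 hg).2.1 hst
  -- Finitely many bonds suffice between `α` and `β`, so from some stage on both growth sequences
  -- contain their ends.
  obtain ⟨k, hk⟩ : ∃ k, ∀ e ∈ F, e.1 ∈ dom (f k) ∧ e.1 + e.2.vec ∈ dom (g k) := by
    clear hsum
    classical
    induction F using Finset.induction_on with
    | empty => exact ⟨0, by simp⟩
    | insert e F _ ih =>
      obtain ⟨k, hk⟩ := ih fun e he => hF e (Finset.mem_insert_of_mem he)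
      obtain ⟨h1, h2⟩ := hF e (Finset.mem_insert_self _ _)
      obtain ⟨t, ht⟩ := mem_dom.1 h1
      obtain ⟨t', ht'⟩ := mem_dom.1 h2
      obtain ⟨i, hi⟩ := (hf.2 _ _).1 ht
      obtain ⟨j, hj⟩ := (hg.2 _ _).1 ht'
      refine ⟨max k (max i j), fun e' he' => ?_⟩
      rcases Finset.mem_insert.1 he' with rfl | he'
      · exact ⟨mem_dom.2 ⟨_, growth_mono hf (by omega) hi⟩,
          mem_dom.2 ⟨_, growth_mono hg (by omega) hj⟩⟩
      · exact ⟨hdom (fun p t h => growth_mono hf (by omega) h) (hk e' he').1,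
          hdom (fun p t h => growth_mono hg (by omega) h) (hk e' he').2⟩
  have hstab : ∀ i j, k ≤ i → k ≤ j → Stable S.temp (union (f i) (g j)) := by
    intro i j hi hj
    have h1 : ∀ e ∈ F, e.1 ∈ dom (f i) ∧ e.1 + e.2.vec ∈ dom (g j) := fun e he =>
      ⟨hdom (fun p t h => growth_mono hf hi h) (hk e he).1,
        hdom (fun p t h => growth_mono hg hj h) (hk e he).2⟩
    refine stable_union (hfs i).2.2 (hgs j).2.2 (hdis i j) F h1 (hsum.trans (le_of_eq ?_))
    refine Finset.sum_congr rfl fun e he => ?_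
    obtain ⟨t, ht⟩ := mem_dom.1 (h1 e he).1
    obtain ⟨t', ht'⟩ := mem_dom.1 (h1 e he).2
    simp only [bond, (union_some hd).2 (Or.inl (hfα i _ _ ht)),
      (union_some hd).2 (Or.inr (hgβ j _ _ ht')), (union_some (hdis i j)).2 (Or.inl ht),
      (union_some (hdis i j)).2 (Or.inr ht')]
  -- The two growth sequences are interleaved from stage `k` on: steps from even `n` advance `f`,
  -- steps from odd `n` advance `g`.
  let h : ℕ → Assembly := fun n => union (f (k + (n + 1) / 2)) (g (k + n / 2))
  refine ⟨h, union α β, ?_, ⟨fun n => ?_, fun p t => ?_⟩, rfl⟩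
  · exact FinProducible.comb _ _ _ (hfin k) (hgin k)
      ⟨f k, self_mem_supertile _, g k, self_mem_supertile _, hdis k k, hstab k k le_rfl le_rfl, rfl⟩
  · rcases Nat.even_or_odd' n with ⟨r, rfl | rfl⟩
    · have e1 : k + (2 * r + 1) / 2 = k + r := by omega
      have e2 : k + (2 * r + 1 + 1) / 2 = k + r + 1 := by omega
      have e3 : k + 2 * r / 2 = k + r := by omega
      simp only [h, e1, e2, e3]
      rcases hf.1 (k + r) with h' | ⟨δ, hδ, hdd, h', _⟩
      · exact Or.inl (by rw [h'])
      · have hδf : dom δ ⊆ dom (f (k + r + 1)) := by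
          rw [h', dom_union]; exact Set.subset_union_right
        refine Or.inr ⟨δ, hδ, ?_, ?_, hstab _ _ (by omega) (by omega)⟩
        · rw [dom_union, Set.disjoint_union_left]
          exact ⟨hdd, ((hdis (k + r + 1) (k + r)).mono_left hδf).symm⟩
        · rw [h', union_assoc', union_assoc',
            union_comm_of_disjoint ((hdis (k + r + 1) (k + r)).mono_left hδf)]
    · have e1 : k + (2 * r + 1) / 2 = k + r := by omega
      have e2 : k + (2 * r + 1 + 1) / 2 = k + r + 1 := by omega
      have e3 : k + (2 * r + 1 + 1 + 1) / 2 = k + r + 1 := by omega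
      simp only [h, e1, e2, e3]
      rcases hg.1 (k + r) with h' | ⟨δ, hδ, hdd, h', _⟩
      · exact Or.inl (by rw [h'])
      · have hδg : dom δ ⊆ dom (g (k + r + 1)) := by
          rw [h', dom_union]; exact Set.subset_union_right
        refine Or.inr ⟨δ, hδ, ?_, ?_, hstab _ _ (by omega) (by omega)⟩
        · rw [dom_union, Set.disjoint_union_left]
          exact ⟨(hdis _ _).mono_right hδg, hdd⟩
        · rw [h', union_assoc']
  · rw [union_some hd, hf.2, hg.2]
    simp only [h, union_some (hdis _ _)]
    constructor
    · rintro (⟨i, hi⟩ | ⟨i, hi⟩)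
      · exact ⟨2 * i, Or.inl (growth_mono hf (by omega) hi)⟩
      · exact ⟨2 * i, Or.inr (growth_mono hg (by omega) hi)⟩
    · rintro ⟨i, hi | hi⟩
      · exact Or.inl ⟨_, hi⟩
      · exact Or.inr ⟨_, hi⟩


/-! ### Macrotiles -/

/-- The side of the bonding tiles which realize the glue on a given side of a macrotile. -/
def Dir.turn : Dir → Dir
  | .north => .east
  | .east => .north
  | .south => .west
  | .west => .south

theorem Dir.turn_turn (d : Dir) : d.turn.turn = d := by cases d <;> rfl

theorem Dir.turn_opp (d : Dir) : d.opp.turn = d.turn.opp := by cases d <;> rfl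

theorem Dir.turn_injective : Function.Injective Dir.turn :=
  Function.LeftInverse.injective Dir.turn_turn

/-- A system of macrotiles for the tiles in `T`: every tile is replaced by a pattern of the same
shape `P`, the copies of which placed at the points of the lattice `m ℤ²` are disjoint. A glue of
positive strength is realized by two bonding sites, and two patterns can only touch with
equal glues of positive strength if they are in lattice position or overlap. -/
structure Scheme (T : Finset TileType) (τ : ℕ) where
  m : ℕ
  two_le : 2 ≤ m
  P : Set (ℤ × ℤ)
  M : TileType → ℤ × ℤ → TileType
  site : Dir → Glue → Bool → ℤ × ℤ
  finite : P.Finite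
  disj : ∀ p q q' : ℤ × ℤ, p - (m : ℤ) • q ∈ P → p - (m : ℤ) • q' ∈ P → q = q'
  near : ∀ q r : ℤ × ℤ, 0 ≤ r.1 → r.1 < m → 0 ≤ r.2 → r.2 < m → (m : ℤ) • q + r ∈ P →
    q.1 ^ 2 + q.2 ^ 2 < 2
  stable : ∀ t (X : Set (ℤ × ℤ)), X.Nonempty → X ⊆ P → (P \ X).Nonempty →
    ∃ F : Finset ((ℤ × ℤ) × Dir),
      (∀ e ∈ F, e.1 ∈ X ∧ e.1 + e.2.vec ∈ P \ X ∧ M t e.1 e.2 = M t (e.1 + e.2.vec) e.2.opp) ∧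
        τ ≤ ∑ e ∈ F, (M t e.1 e.2).strength
  site_mem : ∀ t ∈ T, ∀ D u, site D (t D) u ∈ P
  -- A site on side `D` abuts the matching site on the opposite side of the neighbouring macrotile.
  -- The bond runs in direction `D.turn`, across the side of an arm.
  site_step : ∀ D g u, site D g u + D.turn.vec = (m : ℤ) • D.vec + site D.opp g u
  site_glue : ∀ t ∈ T, ∀ t' ∈ T, ∀ D u, t D = t' D.opp →
    M t (site D (t D) u) D.turn = M t' (site D.opp (t' D.opp) u) D.turn.opp
  site_strength : ∀ t ∈ T, ∀ D, (M t (site D (t D) false) D.turn).strength +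
    (M t (site D (t D) true) D.turn).strength = min (t D).strength τ
  site_inj : ∀ D g u u', site D g u = site D g u' → u = u'
  contact : ∀ t ∈ T, ∀ t' ∈ T, ∀ p v d, p ∈ P → p + d.vec - v ∈ P → (∀ x ∈ P, x - v ∉ P) →
    M t p d = M t' (p + d.vec - v) d.opp → 0 < (M t p d).strength →
      ∃ D u, v = (m : ℤ) • D.vec ∧ t D = t' D.opp ∧ d = D.turn ∧ p = site D (t D) u
  zero_mem : 0 ∈ P
  one_mem : (1, 0) ∈ P
  read : ∀ t ∈ T, ∀ t' ∈ T,
    (∀ p ∈ P, 0 ≤ p.1 → p.1 < m → 0 ≤ p.2 → p.2 < m → M t p = M t' p) → t = t'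
  -- The origin tile occurs nowhere else in a macrotile, so a block can be decoded only in lattice
  -- position.
  origin : ∀ t t' p, p ∈ P → M t p = M t' 0 → p = 0
  -- Label length separates exposed glues from inner ones; this keeps single tiles from attaching to
  -- macrotiles.
  exposed : ∀ t p d, p + d.vec ∉ P → (M t p d).strength = 0 ∨ (M t p d).label.length = 1

namespace Scheme

variable {T : Finset TileType} {τ : ℕ} (S : Scheme T τ)

theorem m_ne : (S.m : ℤ) ≠ 0 := by have := S.two_le; omega

theorem smul_inj {q q' : ℤ × ℤ} (h : (S.m : ℤ) • q = (S.m : ℤ) • q') : q = q' :=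
  smul_right_injective _ S.m_ne h

open Classical in
/-- The assembly in which every tile is replaced by its macrotile. -/
noncomputable def expand (α : Assembly) : Assembly := fun p =>
  if h : ∃ q t, α q = some t ∧ p - (S.m : ℤ) • q ∈ S.P then
    some (S.M h.choose_spec.choose (p - (S.m : ℤ) • h.choose)) else none

/-- By `disj` at most one macrotile covers a position, so the choice made in `expand` is immaterial.
-/
theorem expand_some {α : Assembly} {p : ℤ × ℤ} {u : TileType} :
    S.expand α p = some u ↔
      ∃ q t, α q = some t ∧ p - (S.m : ℤ) • q ∈ S.P ∧ u = S.M t (p - (S.m : ℤ) • q) := by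
  unfold expand
  constructor
  · intro h
    split_ifs at h with h1
    exact ⟨h1.choose, h1.choose_spec.choose, h1.choose_spec.choose_spec.1,
      h1.choose_spec.choose_spec.2, (Option.some.inj h).symm⟩
  · rintro ⟨q, t, h1, h2, rfl⟩
    have h : ∃ q t, α q = some t ∧ p - (S.m : ℤ) • q ∈ S.P := ⟨q, t, h1, h2⟩
    rw [dif_pos h]
    have hq : h.choose = q := S.disj _ _ _ h.choose_spec.choose_spec.2 h2
    have ht : h.choose_spec.choose = t :=
      Option.some.inj (h.choose_spec.choose_spec.1.symm.trans ((congrArg α hq).trans h1))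
    rw [ht, hq]

theorem expand_eq {α : Assembly} {q x : ℤ × ℤ} {t : TileType} (h : α q = some t) (hx : x ∈ S.P) :
    S.expand α ((S.m : ℤ) • q + x) = some (S.M t x) :=
  S.expand_some.2 ⟨q, t, h, by simpa using hx, by simp⟩

theorem mem_dom_expand {α : Assembly} {p : ℤ × ℤ} :
    p ∈ dom (S.expand α) ↔ ∃ q ∈ dom α, p - (S.m : ℤ) • q ∈ S.P := by
  rw [mem_dom]
  constructor
  · rintro ⟨u, hu⟩
    obtain ⟨q, t, h1, h2, _⟩ := S.expand_some.1 hu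
    exact ⟨q, mem_dom.2 ⟨t, h1⟩, h2⟩
  · rintro ⟨q, hq, h⟩
    obtain ⟨t, ht⟩ := mem_dom.1 hq
    exact ⟨_, S.expand_some.2 ⟨q, t, ht, h, rfl⟩⟩

theorem expand_nonempty {α : Assembly} : (dom (S.expand α)).Nonempty ↔ (dom α).Nonempty := by
  constructor
  · rintro ⟨p, hp⟩
    obtain ⟨q, hq, _⟩ := S.mem_dom_expand.1 hp
    exact ⟨q, hq⟩
  · rintro ⟨q, hq⟩
    exact ⟨(S.m : ℤ) • q, S.mem_dom_expand.2 ⟨q, hq, by simpa using S.zero_mem⟩⟩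

theorem expand_disjoint {α β : Assembly} :
    Disjoint (dom (S.expand α)) (dom (S.expand β)) ↔ Disjoint (dom α) (dom β) := by
  simp only [Set.disjoint_left]
  constructor
  · intro h q hq hq'
    exact @h ((S.m : ℤ) • q) (S.mem_dom_expand.2 ⟨q, hq, by simpa using S.zero_mem⟩)
      (S.mem_dom_expand.2 ⟨q, hq', by simpa using S.zero_mem⟩)
  · intro h p hp hp'
    obtain ⟨q, hq, h1⟩ := S.mem_dom_expand.1 hp
    obtain ⟨q', hq', h2⟩ := S.mem_dom_expand.1 hp'
    exact h hq (S.disj _ _ _ h1 h2 ▸ hq')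

theorem expand_union {α β : Assembly} (hd : Disjoint (dom α) (dom β)) :
    S.expand (union α β) = union (S.expand α) (S.expand β) := by
  refine assembly_ext fun p t => ?_
  rw [union_some (S.expand_disjoint.2 hd)]
  simp only [expand_some, union_some hd]
  constructor
  · rintro ⟨q, t, h | h, h1⟩
    · exact Or.inl ⟨q, t, h, h1⟩
    · exact Or.inr ⟨q, t, h, h1⟩
  · rintro (⟨q, t, h, h1⟩ | ⟨q, t, h, h1⟩)
    · exact ⟨q, t, Or.inl h, h1⟩
    · exact ⟨q, t, Or.inr h, h1⟩

theorem expand_translateBy (w : ℤ × ℤ) (α : Assembly) :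
    S.expand (translateBy w α) = translateBy ((S.m : ℤ) • w) (S.expand α) := by
  refine assembly_ext fun p t => ?_
  simp only [translateBy_apply, expand_some]
  constructor
  · rintro ⟨q, t, h, h1⟩
    refine ⟨q - w, t, h, ?_⟩
    rwa [smul_sub, sub_sub, add_sub_cancel]
  · rintro ⟨q, t, h, h1⟩
    refine ⟨q + w, t, by simpa using h, ?_⟩
    rwa [smul_add, add_comm ((S.m : ℤ) • q), ← sub_sub]

theorem expand_finite {α : Assembly} (h : (dom α).Finite) : (dom (S.expand α)).Finite := by
  refine ((h.prod S.finite).image fun x => (S.m : ℤ) • x.1 + x.2).subset fun p hp => ?_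
  obtain ⟨q, hq, h1⟩ := S.mem_dom_expand.1 hp
  exact ⟨(q, p - (S.m : ℤ) • q), ⟨hq, h1⟩, by simp⟩

/-! ### Bonds between macrotiles -/

/-- The two bonding positions of macrotiles that realize the bond between two tiles. -/
def bondEdge (α : Assembly) (x : ((ℤ × ℤ) × Dir) × Bool) : (ℤ × ℤ) × Dir :=
  ((S.m : ℤ) • x.1.1 + (α x.1.1).elim 0 fun t => S.site x.1.2 (t x.1.2) x.2, x.1.2.turn)

/-- The tiles at `e.1` and its neighbour in direction `e.2` have equal abutting glues. -/
def Joined (α : Assembly) (e : (ℤ × ℤ) × Dir) : Prop :=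
  ∃ t t', α e.1 = some t ∧ α (e.1 + e.2.vec) = some t' ∧ t e.2 = t' e.2.opp

variable {S}

theorem joined_of_bond_pos {α : Assembly} {e : (ℤ × ℤ) × Dir} (h : 0 < bond α e.1 e.2) :
    Joined α e := by
  obtain ⟨t, t', h1, h2, h3, _⟩ := bond_pos h
  exact ⟨t, t', h1, h2, h3⟩

theorem bondEdge_mem {α : Assembly} (hα : IsOver T α) {e : (ℤ × ℤ) × Dir} (h : Joined α e)
    (u : Bool) : (S.bondEdge α (e, u)).1 - (S.m : ℤ) • e.1 ∈ S.P ∧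
      (S.bondEdge α (e, u)).1 + e.2.turn.vec - (S.m : ℤ) • (e.1 + e.2.vec) ∈ S.P := by
  obtain ⟨t, t', h1, h2, h3⟩ := h
  have e1 : (S.bondEdge α (e, u)).1 = (S.m : ℤ) • e.1 + S.site e.2 (t e.2) u := by
    simp [bondEdge, h1]
  rw [e1]
  constructor
  · simpa using S.site_mem t (hα _ _ h1) e.2 u
  · have := S.site_mem t' (hα _ _ h2) e.2.opp u
    rw [← h3] at this
    rw [add_assoc, S.site_step, smul_add, ← add_assoc, add_sub_cancel_left]
    exact this

theorem bondEdge_injOn {α : Assembly} (hα : IsOver T α) {e e' : (ℤ × ℤ) × Dir} {u u' : Bool}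
    (h : Joined α e) (h' : Joined α e') (heq : S.bondEdge α (e, u) = S.bondEdge α (e', u')) :
    (e, u) = (e', u') := by
  have h1 := (bondEdge_mem (S := S) hα h u).1
  have h2 := (bondEdge_mem (S := S) hα h' u').1
  rw [heq] at h1
  have hq := S.disj _ _ _ h1 h2
  have hd : e.2 = e'.2 := Dir.turn_injective (congrArg Prod.snd heq)
  obtain rfl : e = e' := Prod.ext hq hd
  obtain ⟨t, t', h3, _, _⟩ := h
  have := congrArg Prod.fst heq
  simp only [bondEdge, h3, Option.elim_some, add_right_inj] at this
  rw [S.site_inj _ _ _ _ this]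

theorem bond_bondEdge {α : Assembly} (hα : IsOver T α) {e : (ℤ × ℤ) × Dir} (h : Joined α e) :
    bond (S.expand α) (S.bondEdge α (e, false)).1 (S.bondEdge α (e, false)).2 +
      bond (S.expand α) (S.bondEdge α (e, true)).1 (S.bondEdge α (e, true)).2 =
        min (bond α e.1 e.2) τ := by
  obtain ⟨t, t', h1, h2, h3⟩ := h
  have key : ∀ u, bond (S.expand α) (S.bondEdge α (e, u)).1 (S.bondEdge α (e, u)).2 =
      (S.M t (S.site e.2 (t e.2) u) e.2.turn).strength := by
    intro u
    have e1 : S.bondEdge α (e, u) = ((S.m : ℤ) • e.1 + S.site e.2 (t e.2) u, e.2.turn) := by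
      simp [bondEdge, h1]
    rw [e1]
    refine bond_some (S.expand_eq h1 (S.site_mem t (hα _ _ h1) e.2 u)) (t' :=
      S.M t' (S.site e.2.opp (t' e.2.opp) u)) ?_ (S.site_glue t (hα _ _ h1) t' (hα _ _ h2) _ _ h3)
    have := S.expand_eq h2 (S.site_mem t' (hα _ _ h2) e.2.opp u)
    rw [← this, ← h3]
    congr 1
    rw [add_assoc, S.site_step, smul_add, ← add_assoc]
  rw [key, key, S.site_strength t (hα _ _ h1), bond_some h1 h2 h3]

/-- By `contact` there are no accidental bonds: macrotiles in lattice position interact only through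
the sites designed for it, and only where the original tiles have equal glues. -/
theorem exists_bondEdge {α : Assembly} (hα : IsOver T α) {p q q' : ℤ × ℤ} {d : Dir}
    (hb : 0 < bond (S.expand α) p d) (hq : p - (S.m : ℤ) • q ∈ S.P)
    (hq' : p + d.vec - (S.m : ℤ) • q' ∈ S.P) (hne : q ≠ q') :
    ∃ D u, Joined α (q, D) ∧ q' = q + D.vec ∧ (p, d) = S.bondEdge α ((q, D), u) := by
  obtain ⟨s, s', h1, h2, h3, h4⟩ := bond_pos hb
  obtain ⟨r, t, h5, h6, rfl⟩ := S.expand_some.1 h1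
  obtain ⟨r', t', h7, h8, rfl⟩ := S.expand_some.1 h2
  obtain rfl := S.disj _ _ _ hq h6
  obtain rfl := S.disj _ _ _ hq' h8
  have hv : p - (S.m : ℤ) • q + d.vec - (S.m : ℤ) • (q' - q) = p + d.vec - (S.m : ℤ) • q' := by
    rw [smul_sub]; abel
  obtain ⟨D, u, h9, h10, h11, h12⟩ := S.contact t (hα _ _ h5) t' (hα _ _ h7)
    (p - (S.m : ℤ) • q) ((S.m : ℤ) • (q' - q)) d hq (by rwa [hv])
    (fun x hx hx' => hne (by
      have := S.disj x 0 (q' - q) (by simpa using hx) hx'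
      exact (sub_eq_zero.1 this.symm).symm))
    (by rwa [hv]) (by rwa [← h4])
  have hq'' : q' = q + D.vec := by rw [← S.smul_inj h9]; abel
  subst hq''
  refine ⟨D, u, ⟨t, t', h5, h7, h10⟩, rfl, ?_⟩
  simp only [bondEdge, h5, Option.elim_some]
  rw [← h12, ← h11]
  simp

/-- A cut `X` of `α` lifts to the union of the macrotiles over `X`. Positive bonds across the lifted
cut join different macrotiles, so they are halves of bonds across `X`, and the two halves of a bond
add up to at most its weight. -/
theorem stable_of_expand {α : Assembly} (hα : IsOver T α) (h : Stable τ (S.expand α)) :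
    Stable τ α := by
  classical
  intro X hX ⟨x, hx⟩ ⟨y, hy, hyX⟩
  obtain ⟨F', hF', hs⟩ := h {p | ∃ q ∈ X, p - (S.m : ℤ) • q ∈ S.P}
    (fun p ⟨q, hq, hp⟩ => S.mem_dom_expand.2 ⟨q, hX hq, hp⟩)
    ⟨(S.m : ℤ) • x, x, hx, by simpa using S.zero_mem⟩
    ⟨(S.m : ℤ) • y, S.mem_dom_expand.2 ⟨y, hy, by simpa using S.zero_mem⟩, fun ⟨q, hq, hp⟩ =>
      hyX (by
        have := S.disj _ _ y hp (by simpa using S.zero_mem)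
        exact this ▸ hq)⟩
  have hedge : ∀ e ∈ F', 0 < bond (S.expand α) e.1 e.2 → ∃ x : ((ℤ × ℤ) × Dir) × Bool,
      Joined α x.1 ∧ x.1.1 ∈ X ∧ x.1.1 + x.1.2.vec ∈ dom α \ X ∧ e = S.bondEdge α x := by
    intro e he hb
    obtain ⟨⟨q, hq, hp⟩, h1, h2⟩ := hF' e he
    obtain ⟨q', hq', hp'⟩ := S.mem_dom_expand.1 h1
    have hqX : q' ∉ X := fun hc => h2 ⟨q', hc, hp'⟩
    obtain ⟨D, u, h3, rfl, h4⟩ := exists_bondEdge hα hb hp hp' (fun hc => hqX (hc ▸ hq))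
    exact ⟨((q, D), u), h3, hq, ⟨hq', hqX⟩, h4⟩
  let F'' := F'.filter fun e => 0 < bond (S.expand α) e.1 e.2
  have hex : ∀ e : F'', ∃ x : ((ℤ × ℤ) × Dir) × Bool, Joined α x.1 ∧ x.1.1 ∈ X ∧
      x.1.1 + x.1.2.vec ∈ dom α \ X ∧ e.1 = S.bondEdge α x := fun e =>
    hedge e.1 (Finset.mem_filter.1 e.2).1 (Finset.mem_filter.1 e.2).2
  choose φ hφ1 hφ2 hφ3 hφ4 using hex
  let F : Finset ((ℤ × ℤ) × Dir) := Finset.univ.image fun e => (φ e).1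
  have hF : ∀ e ∈ F, Joined α e ∧ e.1 ∈ X ∧ e.1 + e.2.vec ∈ dom α \ X := by
    intro e he
    obtain ⟨e', _, rfl⟩ := Finset.mem_image.1 he
    exact ⟨hφ1 e', hφ2 e', hφ3 e'⟩
  refine ⟨F, fun e he => (hF e he).2, hs.trans ?_⟩
  calc ∑ e ∈ F', bond (S.expand α) e.1 e.2
      = ∑ e ∈ F'', bond (S.expand α) e.1 e.2 := by
        refine (Finset.sum_filter_of_ne fun e _ hne => Nat.pos_of_ne_zero hne).symm
    _ ≤ ∑ e ∈ (F ×ˢ (Finset.univ : Finset Bool)).image (S.bondEdge α),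
          bond (S.expand α) e.1 e.2 := by
        refine Finset.sum_le_sum_of_subset fun e he => Finset.mem_image.2 ⟨φ ⟨e, he⟩, ?_, ?_⟩
        · exact Finset.mem_product.2 ⟨Finset.mem_image.2 ⟨⟨e, he⟩, Finset.mem_univ _, rfl⟩,
            Finset.mem_univ _⟩
        · exact (hφ4 ⟨e, he⟩).symm
    _ = ∑ x ∈ F ×ˢ (Finset.univ : Finset Bool),
          bond (S.expand α) (S.bondEdge α x).1 (S.bondEdge α x).2 := by
        refine Finset.sum_image fun x hx y hy hxy => ?_
        exact bondEdge_injOn hα (hF _ (Finset.mem_product.1 hx).1).1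
          (hF _ (Finset.mem_product.1 hy).1).1 hxy
    _ = ∑ e ∈ F, min (bond α e.1 e.2) τ := by
        rw [Finset.sum_product]
        refine Finset.sum_congr rfl fun e he => ?_
        rw [Fintype.sum_bool, add_comm, bond_bondEdge hα (hF e he).1]
    _ ≤ ∑ e ∈ F, bond α e.1 e.2 := Finset.sum_le_sum fun e _ => min_le_left _ _

/-- A single summand that reaches `n` suffices by itself; if there is none, truncation changes
nothing. -/
theorem le_sum_min {ι : Type*} {F : Finset ι} {f : ι → ℕ} {n : ℕ} (h : n ≤ ∑ i ∈ F, f i) :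
    n ≤ ∑ i ∈ F, min (f i) n := by
  by_cases h1 : ∃ i ∈ F, n ≤ f i
  · obtain ⟨i, hi, h1⟩ := h1
    calc n = min (f i) n := by omega
      _ ≤ _ := Finset.single_le_sum (f := fun i => min (f i) n) (fun _ _ => Nat.zero_le _) hi
  · push Not at h1
    refine h.trans (le_of_eq (Finset.sum_congr rfl fun i hi => ?_))
    have := h1 i hi
    omega

/-- A cut either splits some macrotile, whose inner bonds then contribute `τ`, or it is a union of
whole macrotiles. In the second case it is determined by the lattice points that it contains, comes
from a cut of `α`, and truncating bonds at `τ` does no harm by `le_sum_min`. -/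
theorem stable_expand {α : Assembly} (hα : IsOver T α) (h : Stable τ α) :
    Stable τ (S.expand α) := by
  classical
  intro Y hY ⟨x, hx⟩ ⟨y, hy, hyY⟩
  by_cases hsplit : ∃ q ∈ dom α, (∃ x ∈ S.P, (S.m : ℤ) • q + x ∈ Y) ∧
      (∃ x ∈ S.P, (S.m : ℤ) • q + x ∉ Y)
  · obtain ⟨q, hq, ⟨a, ha, haY⟩, ⟨b, hb, hbY⟩⟩ := hsplit
    obtain ⟨t, ht⟩ := mem_dom.1 hq
    obtain ⟨F, hF, hs⟩ := S.stable t {x | x ∈ S.P ∧ (S.m : ℤ) • q + x ∈ Y} ⟨a, ha, haY⟩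
      (fun x hx => hx.1) ⟨b, hb, fun h => hbY h.2⟩
    have hinj : Function.Injective fun e : (ℤ × ℤ) × Dir => ((S.m : ℤ) • q + e.1, e.2) := by
      intro e e' h
      simp only [Prod.mk.injEq, add_right_inj] at h
      exact Prod.ext h.1 h.2
    refine ⟨F.image fun e => ((S.m : ℤ) • q + e.1, e.2), ?_, ?_⟩
    · intro e he
      obtain ⟨e', he', rfl⟩ := Finset.mem_image.1 he
      obtain ⟨h1, ⟨h2, h3⟩, _⟩ := hF e' he'
      refine ⟨h1.2, ?_, ?_⟩
      · exact S.mem_dom_expand.2 ⟨q, hq, by simpa [add_assoc] using h2⟩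
      · exact fun hc => h3 ⟨h2, by simpa [add_assoc] using hc⟩
    · rw [Finset.sum_image hinj.injOn]
      refine hs.trans (le_of_eq (Finset.sum_congr rfl fun e he => ?_))
      obtain ⟨h1, ⟨h2, _⟩, h4⟩ := hF e he
      exact (bond_some (S.expand_eq ht h1.1)
        (by rw [add_assoc]; exact S.expand_eq ht h2) h4).symm
  · push Not at hsplit
    have hiff : ∀ q ∈ dom α, ∀ a ∈ S.P, ∀ b ∈ S.P,
        (S.m : ℤ) • q + a ∈ Y → (S.m : ℤ) • q + b ∈ Y := fun q hq a ha b hb hab =>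
      hsplit q hq ⟨a, ha, hab⟩ b hb
    obtain ⟨q, hq, hxq⟩ := S.mem_dom_expand.1 (hY hx)
    obtain ⟨r, hr, hyr⟩ := S.mem_dom_expand.1 hy
    obtain ⟨F, hF, hs⟩ := h {q | q ∈ dom α ∧ (S.m : ℤ) • q + 0 ∈ Y} (fun q hq => hq.1)
      ⟨q, hq, hiff q hq _ hxq _ S.zero_mem (by simpa using hx)⟩
      ⟨r, hr, fun hc => hyY (by simpa using hiff r hr _ S.zero_mem _ hyr hc.2)⟩
    let F' := F.filter fun e => 0 < bond α e.1 e.2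
    have hj : ∀ e ∈ F', Joined α e := fun e he => joined_of_bond_pos (Finset.mem_filter.1 he).2
    have hs' : τ ≤ ∑ e ∈ F', bond α e.1 e.2 := by
      rwa [Finset.sum_filter_of_ne fun e _ hne => Nat.pos_of_ne_zero hne]
    refine ⟨(F' ×ˢ (Finset.univ : Finset Bool)).image (S.bondEdge α), ?_, ?_⟩
    · intro e he
      obtain ⟨⟨e', u⟩, hx, rfl⟩ := Finset.mem_image.1 he
      have he' := (Finset.mem_product.1 hx).1
      obtain ⟨h1, h2, h3⟩ := hF e' (Finset.mem_filter.1 he').1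
      obtain ⟨h4, h5⟩ := bondEdge_mem (S := S) hα (hj e' he') u
      refine ⟨by simpa using hiff _ h1.1 _ S.zero_mem _ h4 h1.2,
        S.mem_dom_expand.2 ⟨_, h2, h5⟩, fun hc => h3 ⟨h2, ?_⟩⟩
      exact hiff _ h2 _ h5 _ S.zero_mem (by simpa [bondEdge] using hc)
    · rw [Finset.sum_image fun x hx y hy hxy => bondEdge_injOn hα
        (hj _ (Finset.mem_product.1 hx).1) (hj _ (Finset.mem_product.1 hy).1) hxy,
        Finset.sum_product]
      refine (le_sum_min hs').trans (le_of_eq (Finset.sum_congr rfl fun e he => ?_))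
      rw [Fintype.sum_bool, add_comm, bond_bondEdge hα (hj e he)]

/-- Two macro assemblies can only form a stable union in lattice position. -/
theorem aligned_of_stable_union (hτ : 0 < τ) {α β : Assembly} (hα : IsOver T α) (hβ : IsOver T β)
    (hα0 : (dom α).Nonempty) (hβ0 : (dom β).Nonempty) {v : ℤ × ℤ}
    (hd : Disjoint (dom (S.expand α)) (dom (translateBy v (S.expand β))))
    (h : Stable τ (union (S.expand α) (translateBy v (S.expand β)))) :
    ∃ w, v = (S.m : ℤ) • w := by
  obtain ⟨F, hF, hs⟩ := exists_bonds_of_stable_union hd (S.expand_nonempty.2 hα0)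
    (dom_translateBy_nonempty.2 (S.expand_nonempty.2 hβ0)) h
  -- As `τ > 0`, at least one bond is positive, and one bond already fixes the relative position.
  obtain ⟨⟨p, d⟩, he, hb⟩ := Finset.exists_ne_zero_of_sum_ne_zero
    (Nat.ne_of_gt (lt_of_lt_of_le hτ hs))
  obtain ⟨hp, hp'⟩ := hF _ he
  obtain ⟨s, s', h1, h2, h3, h4⟩ := bond_pos (Nat.pos_of_ne_zero hb)
  rw [union_some hd] at h1 h2
  have h1 := h1.resolve_right fun hc => Set.disjoint_left.1 hd hp (mem_dom.2 ⟨_, hc⟩)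
  have h2 := h2.resolve_left fun hc => Set.disjoint_left.1 hd (mem_dom.2 ⟨_, hc⟩) hp'
  obtain ⟨q, t, h5, h6, rfl⟩ := S.expand_some.1 h1
  obtain ⟨q', t', h7, h8, rfl⟩ := S.expand_some.1 h2
  have hv : p - (S.m : ℤ) • q + d.vec - (v + (S.m : ℤ) • (q' - q)) =
      p + d.vec - v - (S.m : ℤ) • q' := by rw [smul_sub]; abel
  obtain ⟨D, u, h9, _⟩ := S.contact t (hα _ _ h5) t' (hβ _ _ h7) (p - (S.m : ℤ) • q)
    (v + (S.m : ℤ) • (q' - q)) d h6 (by rwa [hv])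
    (fun x hx hx' => Set.disjoint_left.1 hd
      (S.mem_dom_expand.2 ⟨q, mem_dom.2 ⟨t, h5⟩, by simpa using hx⟩ : x + (S.m : ℤ) • q ∈ _)
      (S.mem_dom_expand.2 ⟨q', mem_dom.2 ⟨t', h7⟩, by
        convert hx' using 1
        rw [smul_sub]; abel⟩))
    (by rw [hv]; exact h3) (by rw [bond_some ((union_some hd).2 (Or.inl h1))
      ((union_some hd).2 (Or.inr h2)) h3] at hb; exact Nat.pos_of_ne_zero hb)
  refine ⟨D.vec + q - q', ?_⟩
  rw [smul_sub, smul_add, ← h9, smul_sub]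
  abel

end Scheme
namespace Scheme

/-! ### Decoding -/

section Decoding

variable {T : Finset TileType} {τ : ℕ} (S : Scheme T τ)

open Classical in
/-- A block represents the tile whose macrotile agrees with it on the common part of the shape and
the block. -/
noncomputable def rep (B : Block S.m) : Option TileType :=
  if h : ∃ t ∈ T, ∀ i j : Fin S.m, (((i : ℕ) : ℤ), ((j : ℕ) : ℤ)) ∈ S.P →
    B i j = some (S.M t (((i : ℕ) : ℤ), ((j : ℕ) : ℤ))) then some h.choose else none

theorem rep_some {B : Block S.m} {t : TileType} : S.rep B = some t ↔
    t ∈ T ∧ ∀ i j : Fin S.m, (((i : ℕ) : ℤ), ((j : ℕ) : ℤ)) ∈ S.P →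
      B i j = some (S.M t (((i : ℕ) : ℤ), ((j : ℕ) : ℤ))) := by
  unfold rep
  constructor
  · intro h
    split_ifs at h with h1
    rw [← Option.some.inj h]
    exact h1.choose_spec
  · intro h
    have h1 : ∃ t ∈ T, ∀ i j : Fin S.m, (((i : ℕ) : ℤ), ((j : ℕ) : ℤ)) ∈ S.P →
      B i j = some (S.M t (((i : ℕ) : ℤ), ((j : ℕ) : ℤ))) := ⟨t, h⟩
    rw [dif_pos h1]
    refine congrArg some (S.read _ h1.choose_spec.1 _ h.1 fun p hp h2 h3 h4 h5 => ?_)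
    obtain ⟨x, y⟩ := p
    obtain ⟨i, rfl⟩ := Int.eq_ofNat_of_zero_le h2
    obtain ⟨j, rfl⟩ := Int.eq_ofNat_of_zero_le h4
    have hi : i < S.m := by simpa using h3
    have hj : j < S.m := by simpa using h5
    have e1 := h1.choose_spec.2 ⟨i, hi⟩ ⟨j, hj⟩ hp
    have e2 := h.2 ⟨i, hi⟩ ⟨j, hj⟩ hp
    exact Option.some.inj (e1.symm.trans e2)

theorem repAssembly_some {α : Assembly} {q : ℤ × ℤ} {t : TileType} :
    repAssembly S.rep α q = some t ↔ t ∈ T ∧ ∀ p ∈ S.P, 0 ≤ p.1 → p.1 < S.m → 0 ≤ p.2 →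
      p.2 < S.m → α ((S.m : ℤ) • q + p) = some (S.M t p) := by
  unfold repAssembly
  rw [rep_some]
  refine and_congr_right fun _ => ⟨fun h p hp h2 h3 h4 h5 => ?_, fun h i j hij => ?_⟩
  · obtain ⟨x, y⟩ := p
    obtain ⟨i, rfl⟩ := Int.eq_ofNat_of_zero_le h2
    obtain ⟨j, rfl⟩ := Int.eq_ofNat_of_zero_le h4
    have hi : i < S.m := by simpa using h3
    have hj : j < S.m := by simpa using h5
    exact h ⟨i, hi⟩ ⟨j, hj⟩ hp
  · exact h _ hij (by simp) (by simp) (by simp) (by simp)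

variable {S}

/-- The corner of a representing block shows an origin tile, which occurs only at the origin of a
macrotile. This determines the translation. -/
theorem origin_of_rep {α : Assembly} {u q : ℤ × ℤ} {t : TileType}
    (h : repAssembly S.rep (translateBy u (S.expand α)) q = some t) :
    ∃ q' t', α q' = some t' ∧ u = (S.m : ℤ) • (q - q') := by
  have hm : (0 : ℤ) < S.m := by have := S.two_le; omega
  have h0 := (S.repAssembly_some.1 h).2 0 S.zero_mem le_rfl hm le_rfl hm
  rw [add_zero, translateBy_apply] at h0
  obtain ⟨q', t', h1, h2, h3⟩ := S.expand_some.1 h0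
  have h4 := S.origin _ _ _ h2 h3.symm
  refine ⟨q', t', h1, ?_⟩
  rw [smul_sub, ← sub_eq_zero, ← neg_eq_zero, ← h4]
  abel

theorem repAssembly_expand {α : Assembly} (hα : IsOver T α) (w : ℤ × ℤ) :
    repAssembly S.rep (translateBy ((S.m : ℤ) • w) (S.expand α)) = translateBy w α := by
  have key : ∀ q t, α (q - w) = some t →
      repAssembly S.rep (translateBy ((S.m : ℤ) • w) (S.expand α)) q = some t := by
    intro q t h
    refine S.repAssembly_some.2 ⟨hα _ _ h, fun p hp _ _ _ _ => ?_⟩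
    rw [← S.expand_eq h hp, translateBy_apply, smul_sub]
    congr 1
    abel
  refine assembly_ext fun q t => ⟨fun h => ?_, fun h => key q t h⟩
  obtain ⟨q', t', h1, h2⟩ := origin_of_rep h
  have h3 := S.smul_inj h2
  have h4 : α (q - w) = some t' := by rw [h3, sub_sub_cancel, h1]
  rw [key q t' h4] at h
  rw [← h]
  exact h4

theorem aligned_of_rep {α : Assembly} {u : ℤ × ℤ}
    (h : (dom (repAssembly S.rep (translateBy u (S.expand α)))).Nonempty) :
    ∃ w, u = (S.m : ℤ) • w := by
  obtain ⟨q, hq⟩ := h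
  obtain ⟨t, ht⟩ := mem_dom.1 hq
  obtain ⟨q', _, _, h⟩ := origin_of_rep ht
  exact ⟨_, h⟩

theorem repSupertile_expand {α : Assembly} (hα : IsOver T α) (h0 : (dom α).Nonempty) :
    repSupertile S.rep (supertile (S.expand α)) = supertile α := by
  ext β
  constructor
  · rintro ⟨hβ, _, ⟨u, rfl⟩, rfl⟩
    obtain ⟨w, rfl⟩ := aligned_of_rep hβ
    exact ⟨w, repAssembly_expand hα w⟩
  · rintro ⟨w, rfl⟩
    exact ⟨dom_translateBy_nonempty.2 h0, _, ⟨_, rfl⟩, repAssembly_expand hα w⟩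

theorem expand_injective {α β : Assembly} (hα : IsOver T α) (hβ : IsOver T β)
    (h : S.expand α = S.expand β) : α = β := by
  have h1 := repAssembly_expand (S := S) hα 0
  have h2 := repAssembly_expand (S := S) hβ 0
  rw [h, h2] at h1
  simpa using h1.symm

/-- A representing block has tiles at both `0` and `(1, 0)`, so one tile is never enough. -/
theorem repSupertile_single (t : TileType) : repSupertile S.rep (supertile (single t)) = ∅ := by
  refine Set.eq_empty_of_forall_notMem ?_
  rintro _ ⟨⟨q, hq⟩, _, ⟨u, rfl⟩, rfl⟩
  obtain ⟨s, hs⟩ := mem_dom.1 hq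
  have hm : (2 : ℤ) ≤ S.m := by exact_mod_cast S.two_le
  have h := (S.repAssembly_some.1 hs).2
  have h0 := h 0 S.zero_mem le_rfl (by simp; omega) le_rfl (by simp; omega)
  have h1 := h (1, 0) S.one_mem (by simp) (by simp; omega) le_rfl (by simp; omega)
  simp only [translateBy_apply, single] at h0 h1
  split_ifs at h0 h1 with h2 h3
  have := congrArg Prod.fst (h2.trans h3.symm)
  simp at this

theorem clean_single (t : TileType) : CleanSupertile S.rep (supertile (single t)) := by
  refine ⟨fun h => by simp [repSupertile_single] at h, fun _ => ⟨single t, self_mem_supertile _, ?_⟩⟩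
  have hm : (0 : ℤ) < S.m := by have := S.two_le; omega
  have key : ∀ q, BlockNonempty S.m (single t) q → q = 0 := by
    rintro ⟨x, y⟩ ⟨i, j, h⟩
    have h : ((S.m : ℤ) * x + (i : ℕ), (S.m : ℤ) * y + (j : ℕ)) = ((0, 0) : ℤ × ℤ) := by
      by_contra hc
      exact h (if_neg hc)
    simp only [Prod.mk.injEq] at h
    have aux : ∀ (z : ℤ) (k : Fin S.m), (S.m : ℤ) * z + (k : ℕ) = 0 → z = 0 := by
      intro z k hk
      have h1 : ((k : ℕ) : ℤ) < S.m := by exact_mod_cast k.2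
      have h2 : (0 : ℤ) ≤ (k : ℕ) := by positivity
      have h3 : z < 1 := by by_contra hc; nlinarith
      have h4 : -1 < z := by by_contra hc; nlinarith
      omega
    exact Prod.ext (aux _ _ h.1) (aux _ _ h.2)
  intro q q' hq hq'
  rw [key q hq, key q' hq']

theorem clean_expand {α : Assembly} (hα : IsOver T α) (h0 : (dom α).Nonempty) :
    CleanSupertile S.rep (supertile (S.expand α)) := by
  have hrep := repSupertile_expand (S := S) hα h0
  refine ⟨fun _ => ⟨⟨α, hrep⟩, ?_⟩, fun h => ?_⟩
  · rintro _ ⟨u, rfl⟩ hne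
    obtain ⟨w, rfl⟩ := aligned_of_rep hne
    rw [repAssembly_expand hα, ← expand_translateBy]
    refine Or.inl fun q ⟨i, j, h⟩ => ?_
    obtain ⟨q', h1, h2⟩ := S.mem_dom_expand.1 h
    -- The shape meets only the block of its own lattice point and blocks directly adjacent to it.
    have h3 := S.near (q - q') (((i : ℕ) : ℤ), ((j : ℕ) : ℤ)) (by simp) (by simp) (by simp)
      (by simp) (by
        convert h2 using 1
        rw [smul_sub]
        ext <;> simp <;> ring)
    refine ⟨q'.1 - q.1, q'.2 - q.2, ?_, ?_⟩
    · simp only [Prod.fst_sub, Prod.snd_sub] at h3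
      nlinarith
    · convert h1 using 1
      ext <;> simp
  · rw [hrep] at h
    exact absurd (self_mem_supertile α) (by simp [h])

end Decoding

/-! ### Simulation -/

section Simulation

theorem sound_of_producible {T : System} {α : Assembly} (hα : supertile α ∈ Producible T) : Sound T α := by
  obtain ⟨α', h1, h2⟩ := producible_spec hα
  obtain ⟨u, rfl⟩ := eq_translateBy_of_supertile_eq h1
  exact h2.translateBy u

/-- At most one side of the tile can bind to the exposed glues of macrotiles, and no glue of the
tile suffices for an attachment. -/
def Inert (τ : ℕ) (u : TileType) : Prop :=
  (∀ d, (u d).strength < τ) ∧ ∃ d₀, ∀ d, d ≠ d₀ → (u d).strength = 0 ∨ (u d).label.length ≠ 1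

theorem single_translateBy_self (x : ℤ × ℤ) (u : TileType) :
    translateBy x (single u) x = some u := by
  rw [translateBy_apply, sub_self]
  exact if_pos rfl

/-- In the cut that isolates the tile only the edge towards `d₀` can contribute, and its strength is
less than `τ`. -/
theorem not_stable_single {τ : ℕ} {u : TileType} {x : ℤ × ℤ} {β : Assembly} {d₀ : Dir}
    (hd : Disjoint (dom (translateBy x (single u))) (dom β)) (hβ : (dom β).Nonempty)
    (hu : (u d₀).strength < τ)
    (h : ∀ d t, d ≠ d₀ → β (x + d.vec) = some t → u d = t d.opp → (u d).strength = 0) :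
    ¬ Stable τ (union (translateBy x (single u)) β) := by
  classical
  intro hst
  have hx : ∀ p, p ∈ dom (translateBy x (single u)) → p = x := by
    intro p hp
    by_contra hc
    refine hp (if_neg fun h => hc ?_)
    exact sub_eq_zero.1 h
  have hxu := single_translateBy_self x u
  obtain ⟨F, hF, hs⟩ := exists_bonds_of_stable_union hd ⟨x, mem_dom.2 ⟨u, hxu⟩⟩ hβ hst
  have hb : ∀ d, bond (union (translateBy x (single u)) β) x d ≤ if d = d₀ then (u d₀).strength else 0 := by
    intro d
    rcases Nat.eq_zero_or_pos (bond (union (translateBy x (single u)) β) x d) with h0 | h0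
    · omega
    obtain ⟨s, t, h1, h2, h3, h4⟩ := bond_pos h0
    rw [(union_some hd).2 (Or.inl hxu)] at h1
    obtain rfl := Option.some.inj h1
    have h2 := ((union_some hd).1 h2).resolve_left fun hc => by
      have := hx _ (mem_dom.2 ⟨_, hc⟩)
      cases d <;> simp [Dir.vec, Prod.ext_iff] at this
    rw [h4]
    split_ifs with h5
    · rw [h5]
    · exact (h d t h5 h2 h3).le
  have hle : ∑ e ∈ F, bond (union (translateBy x (single u)) β) e.1 e.2 ≤
      ∑ e ∈ F, if e = (x, d₀) then (u d₀).strength else 0 := by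
    refine Finset.sum_le_sum fun e he => ?_
    obtain ⟨p, d⟩ := e
    obtain rfl := hx p (hF _ he).1
    refine (hb d).trans (le_of_eq ?_)
    by_cases h5 : d = d₀ <;> simp [h5]
  rw [Finset.sum_ite_eq'] at hle
  split_ifs at hle <;> omega

/-- `U` consists of the tiles of a scheme for the tiles of `T` and the expanded initial
supertiles. -/
structure Hosts {T : System} (S : Scheme T.tiles T.temp) (U : System) : Prop where
  temp : U.temp = T.temp
  pos : 0 < T.temp
  init : ∀ s, s ∈ U.init ↔ (∃ t ∈ U.tiles, s = supertile (single t)) ∨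
    ∃ α, supertile α ∈ T.init ∧ s = supertile (S.expand α)
  inert : ∀ u ∈ U.tiles, Inert T.temp u

variable {T U : System} {S : Scheme T.tiles T.temp} (H : Hosts S U)

include H

theorem not_stable_single_expand {u : TileType} (hu : u ∈ U.tiles) {α : Assembly}
    (h0 : (dom α).Nonempty) {x v : ℤ × ℤ}
    (hd : Disjoint (dom (translateBy x (single u))) (dom (translateBy v (S.expand α)))) :
    ¬ Stable T.temp (union (translateBy x (single u)) (translateBy v (S.expand α))) := by
  obtain ⟨hu1, d₀, hu2⟩ := H.inert u hu
  refine not_stable_single hd (dom_translateBy_nonempty.2 (S.expand_nonempty.2 h0)) (hu1 d₀)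
    fun d t hne ht heq => ?_
  rcases hu2 d hne with h | h
  · exact h
  obtain ⟨q, s, h1, h2, rfl⟩ := S.expand_some.1 ht
  -- The cell `x` is not covered by the macrotile, so the side of its tile facing `x` is exposed.
  have hc : x + d.vec - v - (S.m : ℤ) • q + d.opp.vec ∉ S.P := fun hc =>
    Set.disjoint_left.1 hd (mem_dom.2 ⟨u, single_translateBy_self x u⟩ : x ∈ _)
      (S.mem_dom_expand.2 ⟨q, mem_dom.2 ⟨s, h1⟩, by
        convert hc using 1
        rw [Dir.opp_vec]
        abel⟩)
  rcases S.exposed s _ d.opp hc with h3 | h3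
  · rw [heq]; exact h3
  · rw [heq] at h
    exact absurd h3 h

theorem not_stable_single_single {u u' : TileType} (hu : u ∈ U.tiles) {x y : ℤ × ℤ}
    (hd : Disjoint (dom (translateBy x (single u))) (dom (translateBy y (single u')))) :
    ¬ Stable T.temp (union (translateBy x (single u)) (translateBy y (single u'))) := by
  have hy : (dom (translateBy y (single u'))).Nonempty := ⟨y, mem_dom.2 ⟨u', single_translateBy_self y u'⟩⟩
  have hs : ∀ (d : Dir) t, translateBy y (single u') (x + d.vec) = some t → x + d.vec = y := by
    intro d t h
    by_contra hc
    have : ¬ (x + d.vec - y = (0, 0)) := fun h => hc (sub_eq_zero.1 h)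
    simp [single, this] at h
  -- Two single tiles abut along at most one side, and one side is too weak.
  by_cases h : ∃ d₀ : Dir, x + d₀.vec = y
  · obtain ⟨d₀, h⟩ := h
    refine not_stable_single hd hy ((H.inert u hu).1 d₀) fun d t hne ht _ => absurd ?_ hne
    have := (hs d t ht).trans h.symm
    rw [add_right_inj] at this
    revert this
    cases d <;> cases d₀ <;> simp [Dir.vec]
  · exact not_stable_single hd hy ((H.inert u hu).1 .north) fun d t _ ht _ =>
      absurd ⟨d, hs d t ht⟩ h

/-- The bond between the two parts puts `v - u` in the lattice. The union is then itself an
expansion, and its stability descends to `T`. -/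
theorem expand_union_of_stable {α β : Assembly} (hα : Sound T α) (hβ : Sound T β) {u v : ℤ × ℤ}
    (hd : Disjoint (dom (translateBy u (S.expand α))) (dom (translateBy v (S.expand β))))
    (h : Stable T.temp (union (translateBy u (S.expand α)) (translateBy v (S.expand β)))) :
    ∃ w, Disjoint (dom α) (dom (translateBy w β)) ∧ Stable T.temp (union α (translateBy w β)) ∧
      union (translateBy u (S.expand α)) (translateBy v (S.expand β)) =
        translateBy u (S.expand (union α (translateBy w β))) := by
  have e1 : translateBy v (S.expand β) = translateBy u (translateBy (v - u) (S.expand β)) := by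
    rw [translateBy_translateBy, add_sub_cancel]
  rw [e1, dom_translateBy_disjoint] at hd
  rw [e1, ← translateBy_union, stable_translateBy] at h
  obtain ⟨w, hw⟩ := aligned_of_stable_union H.pos hα.1 hβ.1 hα.2.1 hβ.2.1 hd h
  rw [hw, ← expand_translateBy] at hd h
  have hd' := S.expand_disjoint.1 hd
  rw [← S.expand_union hd'] at h
  refine ⟨w, hd', stable_of_expand (isOver_union hα.1 (isOver_translateBy hβ.1)) h, ?_⟩
  rw [e1, ← translateBy_union, hw, ← expand_translateBy, ← S.expand_union hd']

theorem comb_expand {α β : Assembly} (hα : IsOver T.tiles α) (hβ : IsOver T.tiles β)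
    (hd : Disjoint (dom α) (dom β)) (h : Stable T.temp (union α β)) :
    supertile (S.expand (union α β)) ∈ Comb U.temp (supertile (S.expand α))
      (supertile (S.expand β)) := by
  refine ⟨_, self_mem_supertile _, _, self_mem_supertile _, S.expand_disjoint.2 hd, ?_, ?_⟩
  · rw [H.temp, ← S.expand_union hd]
    exact stable_expand (isOver_union hα hβ) h
  · rw [← S.expand_union hd]

/-- Single tiles combine with nothing, so only combinations of two expansions occur in the
induction. -/
theorem finProducible_cases {s : Set Assembly} (h : FinProducible U s) :
    (∃ t ∈ U.tiles, s = supertile (single t)) ∨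
      ∃ α, FinProducible T (supertile α) ∧ s = supertile (S.expand α) := by
  induction h with
  | init s hs =>
    rcases (H.init s).1 hs with h | ⟨α, hα, rfl⟩
    · exact Or.inl h
    · exact Or.inr ⟨α, .init _ hα, rfl⟩
  | comb a b c _ _ hc iha ihb =>
    obtain ⟨A, hA, B, hB, hd, hst, rfl⟩ := hc
    rw [H.temp] at hst
    rcases iha with ⟨t, ht, rfl⟩ | ⟨α, hα, rfl⟩ <;> obtain ⟨u, rfl⟩ := hA <;>
    rcases ihb with ⟨t', ht', rfl⟩ | ⟨β, hβ, rfl⟩ <;> obtain ⟨v, rfl⟩ := hB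
    · exact absurd hst (not_stable_single_single H ht hd)
    · exact absurd hst (not_stable_single_expand H ht (hβ.sound _ (self_mem_supertile _)).2.1 hd)
    · rw [union_comm_of_disjoint hd] at hst
      exact absurd hst (not_stable_single_expand H ht' (hα.sound _ (self_mem_supertile _)).2.1 hd.symm)
    · obtain ⟨w, h1, h2, h3⟩ := expand_union_of_stable H (hα.sound _ (self_mem_supertile _))
        (hβ.sound _ (self_mem_supertile _)) hd hst
      refine Or.inr ⟨_, .comb _ _ _ hα hβ ⟨_, self_mem_supertile _, _, ⟨w, rfl⟩, h1, h2, rfl⟩, ?_⟩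
      rw [h3, supertile_translateBy]

theorem finProducible_expand {s : Set Assembly} (h : FinProducible T s) :
    ∀ α ∈ s, FinProducible U (supertile (S.expand α)) := by
  induction h with
  | init s hs =>
    obtain ⟨α, rfl, _⟩ := T.init_spec s hs
    rintro _ ⟨w, rfl⟩
    rw [expand_translateBy, supertile_translateBy]
    exact .init _ ((H.init _).2 (Or.inr ⟨α, hs, rfl⟩))
  | comb a b c ha hb hc iha ihb =>
    obtain ⟨α, hα, β, hβ, hd, hst, rfl⟩ := hc
    rintro _ ⟨w, rfl⟩
    rw [expand_translateBy, supertile_translateBy]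
    exact .comb _ _ _ (iha α hα) (ihb β hβ)
      (comb_expand H (ha.sound α hα).1 (hb.sound β hβ).1 hd hst)

theorem producible_expand {α : Assembly} (h : supertile α ∈ Producible T) :
    supertile (S.expand α) ∈ Producible U := by
  obtain ⟨f, h0, hf⟩ := exists_growth_of_mem h (self_mem_supertile α)
  refine ⟨fun i => S.expand (f i), _, finProducible_expand H h0 _ (self_mem_supertile _),
    ⟨fun i => ?_, fun p s => ?_⟩, rfl⟩
  · have hi := finProducible_growth h0 hf (i + 1)
    rcases hf.1 i with h | ⟨δ, hδ, hd, h, hst⟩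
    · exact Or.inl (by simp only [h])
    · refine Or.inr ⟨S.expand δ, finProducible_expand H hδ _ (self_mem_supertile _),
        S.expand_disjoint.2 hd, by simp only [h, S.expand_union hd], ?_⟩
      rw [H.temp]
      exact stable_expand (hi.sound _ (self_mem_supertile _)).1 hst
  · simp only [expand_some, hf.2]
    constructor
    · rintro ⟨q, t, ⟨i, hi⟩, h⟩
      exact ⟨i, q, t, hi, h⟩
    · rintro ⟨i, q, t, hi, h⟩
      exact ⟨q, t, ⟨i, hi⟩, h⟩

theorem producible_cases {s : Set Assembly} (h : s ∈ Producible U) :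
    (∃ t ∈ U.tiles, s = supertile (single t)) ∨
      ∃ α, supertile α ∈ Producible T ∧ s = supertile (S.expand α) := by
  classical
  obtain ⟨f, γ, h0, hf, rfl⟩ := h
  rcases finProducible_cases H h0 with ⟨t, ht, h1⟩ | ⟨α, hα, h1⟩
  · left
    -- Nothing can attach to a single tile, so its growth sequence is idle.
    have hconst : ∀ i, f i = f 0 := by
      intro i
      induction i with
      | zero => rfl
      | succ i ih =>
        obtain ⟨u, hu⟩ := eq_translateBy_of_supertile_eq h1
        rcases hf.1 i with h | ⟨δ, hδ, hd, h, hst⟩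
        · rw [h, ih]
        · exfalso
          rw [ih, hu] at h hd
          rw [h, H.temp] at hst
          rcases finProducible_cases H hδ with ⟨t', ht', h2⟩ | ⟨β, hβ, h2⟩ <;>
            obtain ⟨v, rfl⟩ := eq_translateBy_of_supertile_eq h2
          · exact not_stable_single_single H ht hd hst
          · exact not_stable_single_expand H ht (hβ.sound _ (self_mem_supertile _)).2.1 hd hst
    refine ⟨t, ht, ?_⟩
    rw [← h1]
    congr 1
    refine assembly_ext fun p s => ?_
    rw [hf.2]
    exact ⟨fun ⟨i, hi⟩ => hconst i ▸ hi, fun h => ⟨0, h⟩⟩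
  · right
    obtain ⟨u, hu⟩ := eq_translateBy_of_supertile_eq h1
    -- Only expansions attach, and they do so in lattice position; hence the same translation `u`
    -- serves at every stage.
    have step : ∀ i α, f i = translateBy u (S.expand α) → FinProducible T (supertile α) →
        ∃ α', f (i + 1) = translateBy u (S.expand α') ∧ FinProducible T (supertile α') ∧
          (α' = α ∨ Attach T.temp {s | FinProducible T s} α α') := by
      intro i α hi hα
      rcases hf.1 i with h | ⟨δ, hδ, hd, h, hst⟩
      · exact ⟨α, h.trans hi, hα, Or.inl rfl⟩
      rw [hi] at h hd
      rw [h, H.temp] at hst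
      rcases finProducible_cases H hδ with ⟨t', ht', h2⟩ | ⟨β, hβ, h2⟩ <;>
        obtain ⟨v, rfl⟩ := eq_translateBy_of_supertile_eq h2
      · rw [union_comm_of_disjoint hd] at hst
        exact absurd hst
          (not_stable_single_expand H ht' (hα.sound _ (self_mem_supertile _)).2.1 hd.symm)
      · obtain ⟨w, h3, h4, h5⟩ := expand_union_of_stable H (hα.sound _ (self_mem_supertile _))
          (hβ.sound _ (self_mem_supertile _)) hd hst
        refine ⟨_, h.trans h5, .comb _ _ _ hα hβ
          ⟨_, self_mem_supertile _, _, ⟨w, rfl⟩, h3, h4, rfl⟩, Or.inr ⟨_, ?_, h3, rfl, h4⟩⟩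
        rwa [supertile_translateBy]
    have hex : ∀ i, ∃ α, f i = translateBy u (S.expand α) ∧ FinProducible T (supertile α) := by
      intro i
      induction i with
      | zero => exact ⟨α, hu, hα⟩
      | succ i ih =>
        obtain ⟨α', h2, h3⟩ := ih
        obtain ⟨α'', h4, h5, _⟩ := step i α' h2 h3
        exact ⟨α'', h4, h5⟩
    choose g hg1 hg2 using hex
    have hgs : ∀ i, g (i + 1) = g i ∨ Attach T.temp {s | FinProducible T s} (g i) (g (i + 1)) := by
      intro i
      obtain ⟨α', h2, h3, h4⟩ := step i (g i) (hg1 i) (hg2 i)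
      -- The preimages `g i` were chosen independently for each stage; injectivity of `expand`
      -- identifies `g (i + 1)` with the assembly obtained by attachment to `g i`.
      have h5 : translateBy (-u) (translateBy u (S.expand (g (i + 1)))) =
          translateBy (-u) (translateBy u (S.expand α')) := by rw [← hg1, ← h2]
      simp only [translateBy_translateBy, neg_add_cancel, translateBy_zero] at h5
      rwa [expand_injective ((hg2 (i + 1)).sound _ (self_mem_supertile _)).1
        (h3.sound _ (self_mem_supertile _)).1 h5]
    have hmono : ∀ {i j}, i ≤ j → ∀ {q t}, g i q = some t → g j q = some t := by
      intro i j hij q t h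
      induction j, hij using Nat.le_induction with
      | base => exact h
      | succ j _ ih =>
        rcases hgs j with h | ⟨δ, _, hd, h, _⟩
        · rwa [h]
        · rw [h, union_some hd]; exact Or.inl ih
    -- The limit of the increasing assemblies `g i`; its expansion is the limit of the `f i` up to
    -- the translation `u`.
    let δ : Assembly := fun q => if h : ∃ t i, g i q = some t then some h.choose else none
    have hδ : ∀ q t, δ q = some t ↔ ∃ i, g i q = some t := by
      intro q t
      simp only [δ]
      constructor
      · intro h
        split_ifs at h with h2
        rw [← Option.some.inj h]
        exact h2.choose_spec
      · rintro ⟨i, hi⟩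
        have h2 : ∃ t i, g i q = some t := ⟨t, i, hi⟩
        obtain ⟨j, hj⟩ := h2.choose_spec
        rw [dif_pos h2, ← hmono (le_max_left i j) hi, hmono (le_max_right i j) hj]
    refine ⟨δ, ⟨g, δ, hg2 0, ⟨hgs, hδ⟩, rfl⟩, ?_⟩
    rw [← supertile_translateBy u (S.expand δ)]
    congr 1
    refine assembly_ext fun p s => ?_
    rw [hf.2]
    simp only [hg1, translateBy_apply, expand_some, hδ]
    constructor
    · rintro ⟨i, q, t, hi, h⟩
      exact ⟨q, t, ⟨i, hi⟩, h⟩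
    · rintro ⟨q, t, ⟨i, hi⟩, h⟩
      exact ⟨i, q, t, hi, h⟩

theorem producible_rep {s : Set Assembly} (h : s ∈ Producible U)
    (hr : (repSupertile S.rep s).Nonempty) :
    ∃ α, s = supertile (S.expand α) ∧ repSupertile S.rep s = supertile α ∧
      supertile α ∈ Producible T ∧ Sound T α := by
  rcases producible_cases H h with ⟨t, _, rfl⟩ | ⟨α, hα, rfl⟩
  · simp [repSupertile_single] at hr
  · obtain ⟨α', h1, h2⟩ := producible_spec hα
    obtain ⟨u, rfl⟩ := eq_translateBy_of_supertile_eq h1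
    have h3 := h2.translateBy u
    exact ⟨_, rfl, repSupertile_expand h3.1 h3.2.1, hα, h3⟩

theorem equivProductions : EquivProductions U T S.rep := by
  refine ⟨Set.ext fun c => ⟨?_, fun hc => ?_⟩, fun a ha => ?_⟩
  · rintro ⟨⟨s, hs, rfl⟩, hne⟩
    obtain ⟨α, _, h2, h3, _⟩ := producible_rep H hs (Set.nonempty_iff_ne_empty.2 hne)
    rwa [h2]
  · obtain ⟨α, rfl, h2⟩ := producible_spec hc
    refine ⟨⟨_, producible_expand H hc, repSupertile_expand h2.1 h2.2.1⟩, ?_⟩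
    exact Set.nonempty_iff_ne_empty.1 ⟨α, self_mem_supertile α⟩
  · rcases producible_cases H ha with ⟨t, _, rfl⟩ | ⟨α, hα, rfl⟩
    · exact clean_single t
    · have := sound_of_producible hα
      exact clean_expand this.1 this.2.1

theorem follows : Follows T U S.rep := by
  rintro a ha b - ⟨d, hd, A, hA, B, hB, hdis, hst, rfl⟩ hr
  -- Single tiles cannot attach, so every step from a representing supertile attaches an expansion
  -- and is a step of `T`.
  right
  obtain ⟨α, rfl, h2, h3, h4⟩ := producible_rep H ha hr
  obtain ⟨u, rfl⟩ := hA
  rw [H.temp] at hst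
  rcases producible_cases H hd with ⟨t, ht, rfl⟩ | ⟨β, hβ, rfl⟩ <;> obtain ⟨v, rfl⟩ := hB
  · rw [union_comm_of_disjoint hdis] at hst
    exact absurd hst (not_stable_single_expand H ht h4.2.1 hdis.symm)
  · have h5 := sound_of_producible hβ
    obtain ⟨w, h6, h7, h8⟩ := expand_union_of_stable H h4 h5 hdis hst
    refine ⟨supertile β, hβ, ?_⟩
    rw [h2, h8, supertile_translateBy, repSupertile_expand
      (isOver_union h4.1 (isOver_translateBy h5.1)) (by rw [dom_union]; exact h4.2.1.inl)]
    exact ⟨_, self_mem_supertile _, _, ⟨w, rfl⟩, h6, h7, rfl⟩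

/-- A supertile that represents `a` is the expansion of `a`, so no preparatory growth is needed:
`a'` and `b'` themselves combine. -/
theorem stronglyModels : StronglyModels U T S.rep := by
  rintro a ha b hb c hc a' ha' b' hb' rfl rfl
  have hcp := comb_producible ha hb hc
  obtain ⟨α, hα, β, hβ, hd, hst, rfl⟩ := hc
  obtain ⟨α', rfl, h2, -, h3⟩ := producible_rep H ha' ⟨_, hα⟩
  obtain ⟨β', rfl, h4, -, h5⟩ := producible_rep H hb' ⟨_, hβ⟩
  refine ⟨_, ha', _, hb', _, producible_expand H hcp, leads_refl _ _, leads_refl _ _, rfl, rfl,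
    ?_, ?_⟩
  · have := sound_of_producible hcp
    exact repSupertile_expand this.1 this.2.1
  · rw [h2] at hα
    rw [h4] at hβ
    obtain ⟨u, rfl⟩ := hα
    obtain ⟨v, rfl⟩ := hβ
    have := comb_expand H (h3.translateBy u).1 (h5.translateBy v).1 hd hst
    rwa [expand_translateBy, expand_translateBy, supertile_translateBy,
      supertile_translateBy] at this

theorem stronglySimulates : StronglySimulates U T S.m :=
  ⟨by have := S.two_le; omega, S.rep, fun B t h => (S.rep_some.1 h).1, equivProductions H,
    follows H, stronglyModels H⟩

end Simulation
end Scheme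

/-! ### The shape of the macrotiles -/

/-- A comb of `a` horizontal arms of length `2 * a + 2` and thickness `2`, the last one of which
ends in a hook. -/
def InComb (a x y : ℤ) : Prop :=
  0 ≤ x ∧ x < 2 * a + 2 ∧ 4 * a ≤ y ∧ y < 8 * a ∧ (y % 4 < 2 ∨ (2 * a ≤ x ∧ 8 * a - 2 ≤ y))

/-- A square from which combs have been moved from the west side to the east side and from the south
side to the north side. -/
def macroShape (a : ℤ) : Set (ℤ × ℤ) :=
  {p | (0 ≤ p.1 ∧ p.1 < 12 * a ∧ 0 ≤ p.2 ∧ p.2 < 12 * a ∧ ¬ InComb a p.1 p.2 ∧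
    ¬ InComb a p.2 p.1) ∨ InComb a (p.1 - 12 * a) p.2 ∨ InComb a (p.2 - 12 * a) p.1}

theorem mem_macroShape {a x y : ℤ} : (x, y) ∈ macroShape a ↔
    (0 ≤ x ∧ x < 12 * a ∧ 0 ≤ y ∧ y < 12 * a ∧ ¬ InComb a x y ∧ ¬ InComb a y x) ∨
      InComb a (x - 12 * a) y ∨ InComb a (y - 12 * a) x := Iff.rfl

/-! ### Packing by lattice translates, connectedness and rigidity of the shape -/

section Shape

variable {a : ℤ}

theorem macroShape_bounds {x y : ℤ} (ha : 2 ≤ a) (h : (x, y) ∈ macroShape a) :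
    0 ≤ x ∧ x < 24 * a ∧ 0 ≤ y ∧ y < 24 * a ∧ (x < 12 * a ∨ y < 12 * a) := by
  rcases h with h | h | h <;> simp only [InComb] at h <;> omega

theorem macroShape_square {x y : ℤ} (hx : 0 ≤ x) (hx' : x < 12 * a) (hy : 0 ≤ y)
    (hy' : y < 12 * a) : (x, y) ∈ macroShape a ↔ ¬ InComb a x y ∧ ¬ InComb a y x := by
  have h1 : ¬ InComb a (x - 12 * a) y := by simp only [InComb]; omega
  have h2 : ¬ InComb a (y - 12 * a) x := by simp only [InComb]; omega
  rw [mem_macroShape]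
  tauto

theorem macroShape_finite (ha : 2 ≤ a) : (macroShape a).Finite :=
  ((Set.finite_Ico 0 (24 * a)).prod (Set.finite_Ico 0 (24 * a))).subset fun ⟨x, y⟩ hp => by
    have := macroShape_bounds ha hp
    exact ⟨⟨this.1, this.2.1⟩, ⟨this.2.2.1, this.2.2.2.1⟩⟩

theorem macroShape_swap {x y : ℤ} : (x, y) ∈ macroShape a ↔ (y, x) ∈ macroShape a := by
  simp only [mem_macroShape]
  tauto

theorem inComb_double_left {x y : ℤ} : InComb a (2 * x) y ↔ InComb a (2 * x + 1) y := by
  simp only [InComb]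
  omega

theorem inComb_double_right {x y : ℤ} : InComb a x (2 * y) ↔ InComb a x (2 * y + 1) := by
  simp only [InComb]
  omega

/-- All boundaries of the shape lie at even coordinates. Together with `macroShape_swap` this makes
it a union of 2×2 squares, as `exists_square` requires. -/
theorem macroShape_double {x y : ℤ} : (2 * x, y) ∈ macroShape a ↔ (2 * x + 1, y) ∈ macroShape a := by
  have e1 : 2 * x - 12 * a = 2 * (x - 6 * a) := by ring
  have e2 : 2 * x + 1 - 12 * a = 2 * (x - 6 * a) + 1 := by ring
  have e3 : 0 ≤ 2 * x ↔ 0 ≤ 2 * x + 1 := by omega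
  have e4 : 2 * x < 12 * a ↔ 2 * x + 1 < 12 * a := by omega
  rw [mem_macroShape, mem_macroShape, e1, e2, e3, e4, inComb_double_left, inComb_double_left,
    inComb_double_right, inComb_double_right]

/-- Only adjacent translates need checking, since the shape lies in a square of side `24a`, twice
the lattice spacing. -/
theorem macroShape_disjoint_aux {x y i j : ℤ} (ha : 2 ≤ a) (hi : i = -1 ∨ i = 0 ∨ i = 1)
    (hj : j = -1 ∨ j = 0 ∨ j = 1) (h : (x, y) ∈ macroShape a)
    (h' : (x + 12 * a * i, y + 12 * a * j) ∈ macroShape a) : i = 0 ∧ j = 0 := by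
  rcases hi with rfl | rfl | rfl <;> rcases hj with rfl | rfl | rfl <;>
    first
    | exact ⟨rfl, rfl⟩
    | (exfalso
       rcases h with h | h | h <;> rcases h' with h' | h' | h' <;> simp only [InComb] at h h' <;> omega)

theorem abs_le_one {a i x : ℤ} (ha : 2 ≤ a) (hx : 0 ≤ x) (hx' : x < 24 * a)
    (h : 0 ≤ x + 12 * a * i) (h' : x + 12 * a * i < 24 * a) : i = -1 ∨ i = 0 ∨ i = 1 := by
  have h1 : i < 2 := by by_contra hc; nlinarith
  have h2 : -2 < i := by by_contra hc; nlinarith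
  omega

theorem macroShape_disjoint (ha : 2 ≤ a) {m : ℤ} (hm : m = 12 * a) (p q q' : ℤ × ℤ)
    (h : p - m • q ∈ macroShape a) (h' : p - m • q' ∈ macroShape a) : q = q' := by
  subst hm
  obtain ⟨x, y⟩ := p
  obtain ⟨i, j⟩ := q
  obtain ⟨i', j'⟩ := q'
  have e : ((x, y) : ℤ × ℤ) - (12 * a) • (i', j') =
      (x - 12 * a * i + 12 * a * (i - i'), y - 12 * a * j + 12 * a * (j - j')) := by
    ext <;> simp <;> ring
  rw [e] at h'
  have h : (x - 12 * a * i, y - 12 * a * j) ∈ macroShape a := h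
  have b := macroShape_bounds ha h
  have b' := macroShape_bounds ha h'
  have := macroShape_disjoint_aux ha (abs_le_one ha b.1 b.2.1 b'.1 b'.2.1)
    (abs_le_one ha b.2.2.1 b.2.2.2.1 b'.2.2.1 b'.2.2.2.1) h h'
  exact Prod.ext (by simpa [sub_eq_zero] using this.1) (by simpa [sub_eq_zero] using this.2)

theorem macroShape_near (ha : 2 ≤ a) {m : ℤ} (hm : m = 12 * a) (q r : ℤ × ℤ) (h1 : 0 ≤ r.1)
    (h2 : r.1 < m) (h3 : 0 ≤ r.2) (h4 : r.2 < m) (h : m • q + r ∈ macroShape a) :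
    q.1 ^ 2 + q.2 ^ 2 < 2 := by
  subst hm
  obtain ⟨i, j⟩ := q
  obtain ⟨x, y⟩ := r
  have h : (12 * a * i + x, 12 * a * j + y) ∈ macroShape a := h
  have b := macroShape_bounds ha h
  simp only at h1 h2 h3 h4
  have hi : i = 0 ∨ i = 1 := by
    have h1 : i < 2 := by by_contra hc; nlinarith
    have h2 : -1 < i := by by_contra hc; nlinarith
    omega
  have hj : j = 0 ∨ j = 1 := by
    have h1 : j < 2 := by by_contra hc; nlinarith
    have h2 : -1 < j := by by_contra hc; nlinarith
    omega
  rcases hi with rfl | rfl <;> rcases hj with rfl | rfl <;> norm_num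
  -- The remaining block `(1, 1)` is excluded because no point has both coordinates at least `12a`.
  omega

/-- Every edge of the shape belongs to a square in the shape. -/
theorem exists_square (p : ℤ × ℤ) (d : Dir) (h : p ∈ macroShape a) (h' : p + d.vec ∈ macroShape a) :
    ∃ e : Dir, e ≠ d ∧ e ≠ d.opp ∧ p + e.vec ∈ macroShape a ∧ p + e.vec + d.vec ∈ macroShape a := by
  have hx : ∀ x y : ℤ, ∃ e : Dir, (e = .east ∨ e = .west) ∧
      ∀ y, (x, y) ∈ macroShape a → (x, y) + e.vec ∈ macroShape a := by
    intro x y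
    rcases Int.even_or_odd' x with ⟨k, rfl | rfl⟩
    · exact ⟨.east, Or.inl rfl, fun y h => by simpa [Dir.vec] using macroShape_double.1 h⟩
    · exact ⟨.west, Or.inr rfl, fun y h => by simpa [Dir.vec] using macroShape_double.2 h⟩
  have hy : ∀ y : ℤ, ∃ e : Dir, (e = .north ∨ e = .south) ∧
      ∀ x, (x, y) ∈ macroShape a → (x, y) + e.vec ∈ macroShape a := by
    intro y
    rcases Int.even_or_odd' y with ⟨k, rfl | rfl⟩
    · refine ⟨.north, Or.inl rfl, fun x h => ?_⟩
      simpa [Dir.vec] using macroShape_swap.2 (macroShape_double.1 (macroShape_swap.1 h))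
    · refine ⟨.south, Or.inr rfl, fun x h => ?_⟩
      simpa [Dir.vec] using macroShape_swap.2 (macroShape_double.2 (macroShape_swap.1 h))
  obtain ⟨x, y⟩ := p
  cases d
  · obtain ⟨e, he, h1⟩ := hx x y
    refine ⟨e, by rcases he with rfl | rfl <;> simp, by rcases he with rfl | rfl <;> simp [Dir.opp],
      h1 _ h, ?_⟩
    have := h1 (y + 1) (by simpa [Dir.vec] using h')
    rw [add_right_comm]
    simpa [Dir.vec] using this
  · obtain ⟨e, he, h1⟩ := hy y
    refine ⟨e, by rcases he with rfl | rfl <;> simp, by rcases he with rfl | rfl <;> simp [Dir.opp],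
      h1 _ h, ?_⟩
    have := h1 (x + 1) (by simpa [Dir.vec] using h')
    rw [add_right_comm]
    simpa [Dir.vec] using this
  · obtain ⟨e, he, h1⟩ := hx x y
    refine ⟨e, by rcases he with rfl | rfl <;> simp, by rcases he with rfl | rfl <;> simp [Dir.opp],
      h1 _ h, ?_⟩
    have := h1 (y + -1) (by simpa [Dir.vec] using h')
    rw [add_right_comm]
    simpa [Dir.vec] using this
  · obtain ⟨e, he, h1⟩ := hy y
    refine ⟨e, by rcases he with rfl | rfl <;> simp, by rcases he with rfl | rfl <;> simp [Dir.opp],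
      h1 _ h, ?_⟩
    have := h1 (x + -1) (by simpa [Dir.vec] using h')
    rw [add_right_comm]
    simpa [Dir.vec] using this

/-- The distance to the north-east corner of the square along a path within the shape. -/
def rank (a : ℤ) (p : ℤ × ℤ) : ℕ :=
  if p.1 < 12 * a ∧ p.2 < 12 * a then (24 * a - p.1 - p.2).toNat else (24 * a + p.1 + p.2).toNat

theorem rank_square {x y : ℤ} (hx : x < 12 * a) (hy : y < 12 * a) :
    rank a (x, y) = (24 * a - x - y).toNat := if_pos ⟨hx, hy⟩

theorem rank_comb {x y : ℤ} (hx : 12 * a ≤ x) : rank a (x, y) = (24 * a + x + y).toNat :=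
  if_neg fun h => absurd h.1 (not_lt.2 hx)

theorem rank_swap (x y : ℤ) : rank a (x, y) = rank a (y, x) := by
  simp only [rank, and_comm (a := x < 12 * a), add_right_comm _ x y, sub_right_comm _ x y]

/-- From an arm the way leads west towards the square; from the hook it leads south to the last arm.
-/
theorem exists_rank_lt_comb (ha : 2 ≤ a) {x y : ℤ} (h : InComb a (x - 12 * a) y) :
    ∃ d : Dir, (x, y) + d.vec ∈ macroShape a ∧ rank a ((x, y) + d.vec) < rank a (x, y) := by
  simp only [InComb] at h
  rw [rank_comb (by omega)]
  by_cases h1 : y % 4 < 2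
  · refine ⟨.west, ?_⟩
    simp only [Dir.vec, Prod.mk_add_mk, add_zero]
    by_cases h2 : x = 12 * a
    · rw [rank_square (by omega) (by omega), macroShape_square (by omega) (by omega) (by omega)
        (by omega)]
      simp only [InComb]
      omega
    · rw [rank_comb (by omega)]
      refine ⟨Or.inr (Or.inl ?_), by omega⟩
      simp only [InComb]
      omega
  · refine ⟨.south, ?_⟩
    simp only [Dir.vec, Prod.mk_add_mk, add_zero]
    rw [rank_comb (by omega)]
    refine ⟨Or.inr (Or.inl ?_), by omega⟩
    simp only [InComb]
    omega

theorem exists_rank_lt_north {x y : ℤ} (hx : 0 ≤ x) (hx' : x < 12 * a) (hy : 0 ≤ y)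
    (hy' : y + 1 < 12 * a) (h : ¬ InComb a x (y + 1)) (h' : ¬ InComb a (y + 1) x) :
    ∃ d : Dir, (x, y) + d.vec ∈ macroShape a ∧ rank a ((x, y) + d.vec) < rank a (x, y) := by
  refine ⟨.north, ?_⟩
  simp only [Dir.vec, Prod.mk_add_mk, add_zero]
  rw [rank_square hx' hy', rank_square hx' (by omega)]
  exact ⟨(macroShape_square hx hx' (by omega) hy').2 ⟨h, h'⟩, by omega⟩

theorem exists_rank_lt_east {x y : ℤ} (hx : 0 ≤ x) (hx' : x + 1 < 12 * a) (hy : 0 ≤ y)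
    (hy' : y < 12 * a) (h : ¬ InComb a (x + 1) y) (h' : ¬ InComb a y (x + 1)) :
    ∃ d : Dir, (x, y) + d.vec ∈ macroShape a ∧ rank a ((x, y) + d.vec) < rank a (x, y) := by
  refine ⟨.east, ?_⟩
  simp only [Dir.vec, Prod.mk_add_mk, add_zero]
  rw [rank_square hx' hy', rank_square (by omega) hy']
  exact ⟨(macroShape_square (by omega) hx' hy hy').2 ⟨h, h'⟩, by omega⟩

/-- Within the square the way leads north or east. Between the notches of one comb it follows them
inwards; beyond the last notch the cut-out hook blocks this, and the way passes around it, north on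
the west side and east on the south side. After that nothing obstructs the way to the north-east
corner. -/
theorem exists_rank_lt_square (ha : 2 ≤ a) {x y : ℤ} (hx : 0 ≤ x) (hx' : x < 12 * a) (hy : 0 ≤ y)
    (hy' : y < 12 * a) (h : ¬ InComb a x y) (h' : ¬ InComb a y x)
    (hne : x ≠ 12 * a - 1 ∨ y ≠ 12 * a - 1) :
    ∃ d : Dir, (x, y) + d.vec ∈ macroShape a ∧ rank a ((x, y) + d.vec) < rank a (x, y) := by
  have north := exists_rank_lt_north (a := a) hx hx' hy
  have east : _ → _ → _ → _ := fun h => exists_rank_lt_east (a := a) hx h hy hy'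
  simp only [InComb] at h h' north east
  by_cases c1 : 8 * a ≤ x
  · by_cases c2 : y = 12 * a - 1
    · apply east <;> clear north east <;> omega
    · apply north <;> clear north east <;> omega
  by_cases c2 : 8 * a ≤ y
  · apply east <;> clear north east <;> omega
  by_cases c3 : 4 * a ≤ y
  · by_cases c4 : x < 2 * a + 2 ∧ 8 * a - 2 ≤ y
    · apply north <;> clear north east <;> omega
    · apply east <;> clear north east <;> omega
  by_cases c4 : y < 2 * a + 2
  · by_cases c5 : 8 * a - 2 ≤ x
    · apply east <;> clear north east <;> omega
    · apply north <;> clear north east <;> omega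
  · apply east <;> clear north east <;> omega

theorem exists_rank_lt (ha : 2 ≤ a) (p : ℤ × ℤ) (hp : p ∈ macroShape a)
    (hne : p ≠ (12 * a - 1, 12 * a - 1)) :
    ∃ d : Dir, p + d.vec ∈ macroShape a ∧ rank a (p + d.vec) < rank a p := by
  obtain ⟨x, y⟩ := p
  rcases hp with ⟨h1, h2, h3, h4, h5, h6⟩ | h | h
  · refine exists_rank_lt_square ha h1 h2 h3 h4 h5 h6 ?_
    by_contra hc
    push Not at hc
    exact hne (Prod.ext hc.1 hc.2)
  · exact exists_rank_lt_comb ha h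
  · obtain ⟨d, h1, h2⟩ := exists_rank_lt_comb ha h
    refine ⟨d.turn, ?_, ?_⟩
    · cases d <;> simp only [Dir.turn, Dir.vec, Prod.mk_add_mk] at h1 ⊢ <;> exact macroShape_swap.1 h1
    · rw [rank_swap x y]
      cases d <;> simp only [Dir.turn, Dir.vec, Prod.mk_add_mk] at h2 ⊢ <;> rwa [rank_swap]

/-- The shape is connected. -/
theorem macroShape_connected (ha : 2 ≤ a) (Q : ℤ × ℤ → Prop)
    (hQ : ∀ p (d : Dir), p ∈ macroShape a → p + d.vec ∈ macroShape a → (Q p ↔ Q (p + d.vec)))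
    {p q : ℤ × ℤ} (hp : p ∈ macroShape a) (hq : q ∈ macroShape a) (h : Q p) : Q q := by
  have key : ∀ n p, rank a p = n → p ∈ macroShape a → (Q p ↔ Q (12 * a - 1, 12 * a - 1)) := by
    intro n
    induction n using Nat.strong_induction_on with
    | _ n ih =>
      rintro p rfl hp
      by_cases hne : p = (12 * a - 1, 12 * a - 1)
      · rw [hne]
      · obtain ⟨d, h1, h2⟩ := exists_rank_lt ha p hp hne
        rw [hQ p d hp h1]
        exact ih _ h2 _ rfl h1
  exact (key _ q rfl hq).2 ((key _ p rfl hp).1 h)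

/-- A pattern on the shape in which all neighbours are bound with strength at least `τ / 2` is
stable. -/
theorem stable_of_square (ha : 2 ≤ a) {τ : ℕ} (M : TileType → ℤ × ℤ → TileType)
    (hM : ∀ t p d, p ∈ macroShape a → p + d.vec ∈ macroShape a →
      M t p d = M t (p + d.vec) d.opp ∧ τ ≤ 2 * (M t p d).strength)
    (t : TileType) (X : Set (ℤ × ℤ)) (hX : X.Nonempty) (hXP : X ⊆ macroShape a)
    (hPX : (macroShape a \ X).Nonempty) :
    ∃ F : Finset ((ℤ × ℤ) × Dir),
      (∀ e ∈ F, e.1 ∈ X ∧ e.1 + e.2.vec ∈ macroShape a \ X ∧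
        M t e.1 e.2 = M t (e.1 + e.2.vec) e.2.opp) ∧
        τ ≤ ∑ e ∈ F, (M t e.1 e.2).strength := by
  classical
  let Cut : (ℤ × ℤ) × Dir → Prop := fun e => e.1 ∈ X ∧ e.1 + e.2.vec ∈ macroShape a \ X
  -- Two edges of strength at least `τ / 2` suffice, so it remains to find a second edge in every
  -- cut.
  have pair : ∀ e e', e ≠ e' → Cut e → Cut e' → ∃ F : Finset ((ℤ × ℤ) × Dir),
      (∀ e ∈ F, e.1 ∈ X ∧ e.1 + e.2.vec ∈ macroShape a \ X ∧
        M t e.1 e.2 = M t (e.1 + e.2.vec) e.2.opp) ∧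
        τ ≤ ∑ e ∈ F, (M t e.1 e.2).strength := by
    intro e e' hne h h'
    have h1 := hM t e.1 e.2 (hXP h.1) h.2.1
    have h2 := hM t e'.1 e'.2 (hXP h'.1) h'.2.1
    refine ⟨{e, e'}, fun x hx => ?_, ?_⟩
    · rcases Finset.mem_insert.1 hx with rfl | hx
      · exact ⟨h.1, h.2, h1.1⟩
      · obtain rfl := Finset.mem_singleton.1 hx
        exact ⟨h'.1, h'.2, h2.1⟩
    · rw [Finset.sum_pair hne]
      omega
  by_contra hcon
  have noCut : ∀ p (d : Dir), p ∈ X → p + d.vec ∈ macroShape a → p + d.vec ∈ X := by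
    intro p d hp hpd
    by_contra hpX
    refine hcon ?_
    -- The closed path around a square containing the cut edge must cross the cut a second time; the
    -- cases locate that crossing.
    obtain ⟨e, he1, he2, he3, he4⟩ := exists_square p d (hXP hp) hpd
    by_cases h1 : p + e.vec ∈ X
    · by_cases h2 : p + e.vec + d.vec ∈ X
      · have h3 : p + e.vec + d.vec + e.opp.vec = p + d.vec := by rw [Dir.opp_vec]; abel
        refine pair (p, d) (p + e.vec + d.vec, e.opp) (fun h => he2 ?_) ⟨hp, hpd, hpX⟩
          ⟨h2, by rw [h3]; exact ⟨hpd, hpX⟩⟩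
        have h4 : d = e.opp := (Prod.ext_iff.1 h).2
        rw [h4, Dir.opp_opp]
      · refine pair (p, d) (p + e.vec, d) (fun h => ?_) ⟨hp, hpd, hpX⟩ ⟨h1, he4, h2⟩
        have := (Prod.ext_iff.1 h).1
        cases e <;> simp [Dir.vec, Prod.ext_iff] at this
    · exact pair (p, d) (p, e) (fun h => he1 (Prod.ext_iff.1 h).2.symm) ⟨hp, hpd, hpX⟩
        ⟨hp, he3, h1⟩
  obtain ⟨x, hx⟩ := hX
  obtain ⟨y, hy, hyX⟩ := hPX
  refine hyX (macroShape_connected ha (· ∈ X) (fun p d hp hpd =>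
    ⟨fun h => noCut p d h hpd, fun h => ?_⟩) (hXP hx) hy hx)
  have h3 : p + d.vec + d.opp.vec = p := by rw [Dir.opp_vec]; abel
  have := noCut _ d.opp h
  rw [h3] at this
  exact this hp

end Shape

/-! ### The tiles of the macrotiles -/

/-- The positions of the two bonding tiles for the side `D` of a macrotile carrying the glue with
index `k`. -/
def bondSite (a : ℤ) (D : Dir) (k : ℕ × ℕ) (u : Bool) : ℤ × ℤ :=
  match D with
  | .east => (12 * a + (2 * (k.2 : ℤ) + (if u then 1 else 0)), 4 * a + (4 * (k.1 : ℤ) + 1))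
  | .west => (2 * (k.2 : ℤ) + (if u then 1 else 0), 4 * a + (4 * (k.1 : ℤ) + 2))
  | .north => (4 * a + (4 * (k.1 : ℤ) + 1), 12 * a + (2 * (k.2 : ℤ) + (if u then 1 else 0)))
  | .south => (4 * a + (4 * (k.1 : ℤ) + 2), 2 * (k.2 : ℤ) + (if u then 1 else 0))

/-- The position in the interior of a macrotile that marks a glue index. -/
def markSite (a : ℤ) (k : ℕ × ℕ) : ℤ × ℤ := (8 * a + (k.1 : ℤ), 8 * a + (k.2 : ℤ))

/-- The label of the glue between a position and its eastern neighbour. -/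
def markLabel (a : ℤ) (k : Glue → ℕ × ℕ) (t : TileType) (p : ℤ × ℤ) : List Bool :=
  [decide (p = 0), decide (p = markSite a (k (t .north))), decide (p = markSite a (k (t .east))),
    decide (p = markSite a (k (t .south))), decide (p = markSite a (k (t .west)))]

/-- The label of the glue between neighbouring positions in a macrotile. -/
def innerLabel (a : ℤ) (k : Glue → ℕ × ℕ) (t : TileType) (p : ℤ × ℤ) : Dir → List Bool
  | .east => markLabel a k t p
  | .west => markLabel a k t (p + Dir.west.vec)
  | .north => [false, false, false, false, false]
  | .south => [false, false, false, false, false]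

/-- One half of a bond of strength `s`. -/
def halfGlue (s : ℕ) : Bool → Glue
  | false => ⟨[false], s / 2⟩
  | true => ⟨[true], (s + 1) / 2⟩

open Classical in
/-- The tile at position `p` of the macrotile of `t`. -/
noncomputable def macroTile (a : ℤ) (τ : ℕ) (k : Glue → ℕ × ℕ) (t : TileType) (p : ℤ × ℤ) :
    TileType := fun d =>
  if p + d.vec ∈ macroShape a then ⟨innerLabel a k t p d, (τ + 1) / 2⟩
  else if p = bondSite a d.turn (k (t d.turn)) false then halfGlue (min (t d.turn).strength τ) false
  else if p = bondSite a d.turn (k (t d.turn)) true then halfGlue (min (t d.turn).strength τ) true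
  else ⟨[], 0⟩

/-! ### Positions of the bonding sites and the collision of mismatched macrotiles -/

section Sites

variable {a : ℤ}

/-- East sites lie on the upper row of an arm, west sites on the row just above a notch, and the
north and south sites are their mirror images. The columns used are less than `2a`, which leaves the
hook free. -/
theorem bondSite_mem (D : Dir) {k : ℕ × ℕ} (u : Bool) (h1 : (k.1 : ℤ) < a)
    (h2 : (k.2 : ℤ) < a) : bondSite a D k u ∈ macroShape a := by
  have east : ∀ i j : ℤ, 0 ≤ i → i < a → 0 ≤ j → j < 2 * a →
      (12 * a + j, 4 * a + (4 * i + 1)) ∈ macroShape a := by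
    intro i j _ _ _ _
    refine Or.inr (Or.inl ?_)
    simp only [InComb]
    omega
  have west : ∀ i j : ℤ, 0 ≤ i → i < a → 0 ≤ j → j < 2 * a →
      (j, 4 * a + (4 * i + 2)) ∈ macroShape a := by
    intro i j _ _ _ _
    rw [macroShape_square (by omega) (by omega) (by omega) (by omega)]
    simp only [InComb]
    omega
  have hj : 0 ≤ 2 * (k.2 : ℤ) + (if u then 1 else 0) ∧
      2 * (k.2 : ℤ) + (if u then 1 else 0) < 2 * a := by cases u <;> simp <;> omega
  have hi : (0 : ℤ) ≤ k.1 := by omega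
  cases D
  · exact macroShape_swap.1 (east _ _ hi h1 hj.1 hj.2)
  · exact east _ _ hi h1 hj.1 hj.2
  · exact macroShape_swap.1 (west _ _ hi h1 hj.1 hj.2)
  · exact west _ _ hi h1 hj.1 hj.2

theorem bondSite_step {m : ℤ} (hm : m = 12 * a) (D : Dir) (k : ℕ × ℕ) (u : Bool) :
    bondSite a D k u + D.turn.vec = m • D.vec + bondSite a D.opp k u := by
  subst hm
  cases D <;> ext <;> simp [bondSite, Dir.turn, Dir.vec, Dir.opp] <;> ring

theorem bondSite_inj (D : Dir) {k k' : ℕ × ℕ} {u u' : Bool}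
    (h : bondSite a D k u = bondSite a D k' u') : k = k' ∧ u = u' := by
  have key : (k.1 : ℤ) = k'.1 ∧
      2 * (k.2 : ℤ) + (if u then 1 else 0) = 2 * (k'.2 : ℤ) + (if u' then 1 else 0) := by
    cases D <;> simp only [bondSite, Prod.mk.injEq] at h <;> omega
  have h2 : (k.2 : ℤ) = k'.2 ∧ u = u' := by
    have := key.2
    cases u <;> cases u' <;> simp at this ⊢ <;> omega
  exact ⟨Prod.ext (by exact_mod_cast key.1) (by exact_mod_cast h2.1), h2.2⟩

theorem bondSite_side {D D' : Dir} {k k' : ℕ × ℕ} {u u' : Bool} (h1 : (k.1 : ℤ) < a)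
    (h2' : (k'.2 : ℤ) < a)
    (h : bondSite a D k u = bondSite a D' k' u') : D = D' := by
  cases D <;> cases D' <;> first
    | rfl
    | (exfalso
       simp only [bondSite, Prod.mk.injEq] at h
       cases u <;> cases u' <;> simp at h <;> omega)

/-- Macrotiles that touch at bonding sites of different glues overlap. -/
theorem exists_overlap (ha : 2 ≤ a) {m : ℤ} (hm : m = 12 * a) (D : Dir) {k k' : ℕ × ℕ} (u : Bool)
    (h1 : (k.1 : ℤ) < a) (h2 : (k.2 : ℤ) < a) (h1' : (k'.1 : ℤ) < a) (h2' : (k'.2 : ℤ) < a)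
    (hne : k ≠ k') : ∃ x ∈ macroShape a,
      x - (m • D.vec + bondSite a D.opp k u - bondSite a D.opp k' u) ∈ macroShape a := by
  subst hm
  have hne' : ¬ ((k.1 : ℤ) = k'.1 ∧ (k.2 : ℤ) = k'.2) := fun h =>
    hne (Prod.ext (by exact_mod_cast h.1) (by exact_mod_cast h.2))
  -- The lower left cell of the hook on the east side is the point that collides.
  have hook : (12 * a + 2 * a, 8 * a - 2) ∈ macroShape a := by
    refine Or.inr (Or.inl ?_)
    simp only [InComb]
    omega
  -- This is the hook cell as seen from the displaced neighbour. Its row is 2 modulo 4, so it misses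
  -- the notches for the arms; the notch for the hook contains it only if there is no displacement.
  have core : ∀ i j : ℤ, -a < i → i < a → -a < j → j < a → ¬ (i = 0 ∧ j = 0) →
      (2 * a - 2 * j, 8 * a - 2 - 4 * i) ∈ macroShape a := by
    intro i j _ _ _ _ _
    rw [macroShape_square (by omega) (by omega) (by omega) (by omega)]
    simp only [InComb]
    omega
  have core1 := core (k.1 - k'.1) (k.2 - k'.2) (by omega) (by omega) (by omega) (by omega) (by omega)
  -- For the sides south and west the hook belongs to the other macrotile, so the displacement
  -- changes sign.
  have core2 := core (k'.1 - k.1) (k'.2 - k.2) (by omega) (by omega) (by omega) (by omega) (by omega)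
  cases D
  · refine ⟨_, macroShape_swap.1 hook, ?_⟩
    convert macroShape_swap.1 core1 using 1
    ext <;> simp [bondSite, Dir.vec, Dir.opp] <;> ring
  · refine ⟨_, hook, ?_⟩
    convert core1 using 1
    ext <;> simp [bondSite, Dir.vec, Dir.opp] <;> ring
  · refine ⟨_, macroShape_swap.1 core2, ?_⟩
    convert macroShape_swap.1 hook using 1
    ext <;> simp [bondSite, Dir.vec, Dir.opp] <;> ring
  · refine ⟨_, core2, ?_⟩
    convert hook using 1
    ext <;> simp [bondSite, Dir.vec, Dir.opp] <;> ring

theorem markSite_mem {k : ℕ × ℕ} (h1 : (k.1 : ℤ) < a) (h2 : (k.2 : ℤ) < a) :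
    markSite a k ∈ macroShape a ∧ markSite a k + Dir.east.vec ∈ macroShape a := by
  simp only [markSite, Dir.vec, Prod.mk_add_mk]
  rw [macroShape_square (by omega) (by omega) (by omega) (by omega),
    macroShape_square (by omega) (by omega) (by omega) (by omega)]
  simp only [InComb]
  omega

theorem markSite_inj {k k' : ℕ × ℕ} (h : markSite a k = markSite a k') : k = k' := by
  simp only [markSite, Prod.mk.injEq] at h
  exact Prod.ext (by omega) (by omega)

end Sites

/-! ### Glues of the macrotiles -/

section Tiles

variable {a : ℤ} {τ : ℕ} {k : Glue → ℕ × ℕ} {t t' : TileType} {p : ℤ × ℤ} {d : Dir}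

theorem length_innerLabel : (innerLabel a k t p d).length = 5 := by cases d <;> rfl

theorem length_halfGlue (s : ℕ) (u : Bool) : (halfGlue s u).label.length = 1 := by cases u <;> rfl

theorem halfGlue_inj {s s' : ℕ} {u u' : Bool} (h : halfGlue s u = halfGlue s' u') : u = u' := by
  have := congrArg Glue.label h
  cases u <;> cases u' <;> simp [halfGlue] at this ⊢

theorem macroTile_inner (h : p + d.vec ∈ macroShape a) :
    macroTile a τ k t p d = ⟨innerLabel a k t p d, (τ + 1) / 2⟩ := if_pos h

theorem macroTile_outer (h : p + d.vec ∉ macroShape a) :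
    (∃ u, p = bondSite a d.turn (k (t d.turn)) u ∧
      macroTile a τ k t p d = halfGlue (min (t d.turn).strength τ) u) ∨
      macroTile a τ k t p d = ⟨[], 0⟩ := by
  unfold macroTile
  rw [if_neg h]
  split_ifs with h1 h2
  · exact Or.inl ⟨false, h1, rfl⟩
  · exact Or.inl ⟨true, h2, rfl⟩
  · exact Or.inr rfl

theorem macroTile_inner_symm (h : p ∈ macroShape a) (h' : p + d.vec ∈ macroShape a) :
    macroTile a τ k t p d = macroTile a τ k t (p + d.vec) d.opp := by
  have h1 : p + d.vec + d.opp.vec = p := by rw [Dir.opp_vec]; abel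
  rw [macroTile_inner h', macroTile_inner (by rwa [h1])]
  congr 1
  cases d <;> simp only [innerLabel, Dir.opp]
  · exact congrArg _ h1.symm

/-- The cell across a bonding site belongs to the adjacent lattice copy of the shape, which is
disjoint from the shape itself. -/
theorem bondSite_outer (ha : 2 ≤ a) (D : Dir) {i : ℕ × ℕ} (u : Bool) (h1 : (i.1 : ℤ) < a)
    (h2 : (i.2 : ℤ) < a) : bondSite a D i u + D.turn.vec ∉ macroShape a := by
  intro h
  have h3 := bondSite_mem D.opp u h1 h2
  have h4 := macroShape_disjoint ha rfl _ 0 D.vec (by simpa using h) (by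
    rw [bondSite_step rfl]
    simpa using h3)
  cases D <;> simp [Dir.vec, Prod.ext_iff] at h4

theorem macroTile_bondSite (ha : 2 ≤ a) (D : Dir) (u : Bool) (h1 : ((k (t D)).1 : ℤ) < a)
    (h2 : ((k (t D)).2 : ℤ) < a) : macroTile a τ k t (bondSite a D (k (t D)) u) D.turn =
      halfGlue (min (t D).strength τ) u := by
  have h3 : bondSite a D (k (t D)) true ≠ bondSite a D (k (t D)) false := fun h =>
    absurd (bondSite_inj D h).2 (by simp)
  unfold macroTile
  rw [if_neg (bondSite_outer ha D u h1 h2), Dir.turn_turn]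
  cases u
  · rw [if_pos rfl]
  · rw [if_neg h3, if_pos rfl]

/-- The bit for side `D` is set exactly on the eastern glue of the mark of `k (t D)`; comparison at
that mark recovers the index. -/
theorem eq_of_markLabel (hk : ∀ D, ((k (t D)).1 : ℤ) < a ∧ ((k (t D)).2 : ℤ) < a)
    (h : ∀ p ∈ macroShape a, 0 ≤ p.1 → p.1 < 12 * a → 0 ≤ p.2 → p.2 < 12 * a →
      macroTile a τ k t p = macroTile a τ k t' p) (D : Dir) : k (t D) = k (t' D) := by
  obtain ⟨h1, h2⟩ := hk D
  obtain ⟨h3, h4⟩ := markSite_mem h1 h2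
  have h5 := congrFun (h _ h3 (by simp only [markSite]; omega) (by simp only [markSite]; omega)
    (by simp only [markSite]; omega) (by simp only [markSite]; omega)) .east
  rw [macroTile_inner h4, macroTile_inner h4] at h5
  have h6 := congrArg Glue.label h5
  simp only [innerLabel, markLabel, List.cons.injEq, decide_eq_decide] at h6
  refine markSite_inj (a := a) ?_
  cases D
  · exact h6.2.1.1 rfl
  · exact h6.2.2.1.1 rfl
  · exact h6.2.2.2.1.1 rfl
  · exact h6.2.2.2.2.1.1 rfl

theorem macroTile_origin (ha : 2 ≤ a) (h : macroTile a τ k t p = macroTile a τ k t' 0) : p = 0 := by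
  have h1 : (0 : ℤ × ℤ) + Dir.east.vec ∈ macroShape a := by
    change ((0 : ℤ) + 1, (0 : ℤ) + 0) ∈ _
    rw [macroShape_square (by omega) (by omega) (by omega) (by omega)]
    simp only [InComb]
    omega
  have h2 := congrArg Glue.label (congrFun h .east)
  rw [macroTile_inner h1] at h2
  by_cases h3 : p + Dir.east.vec ∈ macroShape a
  · rw [macroTile_inner h3] at h2
    simp only [innerLabel, markLabel, List.cons.injEq, decide_eq_decide] at h2
    exact h2.1.2 trivial
  -- An exposed side has a label of length at most one, whereas the eastern label at the origin has
  -- length five.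
  · have h4 := congrArg List.length h2
    rw [length_innerLabel] at h4
    rcases macroTile_outer (τ := τ) (k := k) (t := t) h3 with ⟨u, _, h5⟩ | h5
    · rw [h5, length_halfGlue] at h4
      omega
    · rw [h5] at h4
      simp at h4

/-- Disjointness makes both abutting glues exposed, and positive strength makes them halves of
bonds, the same half because the labels agree. The displacement is thus determined by the two glue
indices: equal indices give lattice position, different ones contradict disjointness by
`exists_overlap`. -/
theorem macroTile_contact (ha : 2 ≤ a) {m : ℤ} (hm : m = 12 * a)
    (hk : ∀ D, ((k (t D)).1 : ℤ) < a ∧ ((k (t D)).2 : ℤ) < a)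
    (hk' : ∀ D, ((k (t' D)).1 : ℤ) < a ∧ ((k (t' D)).2 : ℤ) < a)
    (hinj : ∀ D D', k (t D) = k (t' D') → t D = t' D') {v : ℤ × ℤ} (hp : p ∈ macroShape a)
    (hp' : p + d.vec - v ∈ macroShape a) (hv : ∀ x ∈ macroShape a, x - v ∉ macroShape a)
    (h : macroTile a τ k t p d = macroTile a τ k t' (p + d.vec - v) d.opp)
    (hs : 0 < (macroTile a τ k t p d).strength) :
    ∃ D u, v = m • D.vec ∧ t D = t' D.opp ∧ d = D.turn ∧ p = bondSite a D (k (t D)) u := by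
  have h1 : p + d.vec ∉ macroShape a := fun hc => hv _ hc hp'
  rcases macroTile_outer (τ := τ) (k := k) (t := t) h1 with ⟨u, h2, h3⟩ | h2
  swap
  · simp [h2] at hs
  have h4 : p + d.vec - v + d.opp.vec ∉ macroShape a := fun hc => hv p hp (by
    convert hc using 1
    rw [Dir.opp_vec]
    abel)
  rw [h3] at h
  rcases macroTile_outer (τ := τ) (k := k) (t := t') h4 with ⟨u', h5, h6⟩ | h5
  swap
  · have := congrArg (fun g : Glue => g.label.length) h
    simp [h5, length_halfGlue] at this
  rw [h6] at h
  obtain rfl := halfGlue_inj h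
  rw [Dir.turn_opp] at h5
  have hv' : v = m • d.turn.vec + bondSite a d.turn.opp (k (t d.turn)) u -
      bondSite a d.turn.opp (k (t' d.turn.opp)) u := by
    rw [← h5, ← bondSite_step hm, ← h2, Dir.turn_turn]
    abel
  by_cases h7 : k (t d.turn) = k (t' d.turn.opp)
  · refine ⟨d.turn, u, ?_, hinj _ _ h7, (Dir.turn_turn d).symm, h2⟩
    rw [hv', h7]
    abel
  · obtain ⟨x, hx, hx'⟩ := exists_overlap ha hm d.turn u (hk _).1 (hk _).2 (hk' _).1 (hk' _).2 h7
    rw [← hv'] at hx'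
    exact absurd hx' (hv x hx)

end Tiles

/-- The macrotiles for a set of tiles the glues of which are indexed by pairs of numbers less
than `a`. -/
noncomputable def gridScheme (T : Finset TileType) (τ a : ℕ) (k : Glue → ℕ × ℕ) (ha : 2 ≤ a)
    (hk : ∀ g ∈ glues T, (k g).1 < a ∧ (k g).2 < a) (hinj : Set.InjOn k (glues T)) :
    Scheme T τ where
  m := 12 * a
  two_le := by omega
  P := macroShape a
  M := macroTile a τ k
  site := fun D g => bondSite a D (k g)
  finite := macroShape_finite (by omega)
  disj := macroShape_disjoint (by omega) (by push_cast; rfl)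
  near := macroShape_near (by omega) (by push_cast; rfl)
  stable := stable_of_square (by omega) _ fun t p d hp hd =>
    ⟨macroTile_inner_symm hp hd, by rw [macroTile_inner hd]; dsimp only; omega⟩
  site_mem := fun t ht D u => bondSite_mem D u
    (by exact_mod_cast (hk _ ⟨t, ht, D, rfl⟩).1) (by exact_mod_cast (hk _ ⟨t, ht, D, rfl⟩).2)
  site_step := fun D g u => bondSite_step (by push_cast; rfl) D _ u
  site_glue := fun t ht t' ht' D u h => by
    rw [macroTile_bondSite (by omega) D u (by exact_mod_cast (hk _ ⟨t, ht, D, rfl⟩).1)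
      (by exact_mod_cast (hk _ ⟨t, ht, D, rfl⟩).2), ← Dir.turn_opp,
      macroTile_bondSite (by omega) D.opp u (by exact_mod_cast (hk _ ⟨t', ht', D.opp, rfl⟩).1)
      (by exact_mod_cast (hk _ ⟨t', ht', D.opp, rfl⟩).2), h]
  site_strength := fun t ht D => by
    have h1 : ((k (t D)).1 : ℤ) < a := by exact_mod_cast (hk _ ⟨t, ht, D, rfl⟩).1
    have h2 : ((k (t D)).2 : ℤ) < a := by exact_mod_cast (hk _ ⟨t, ht, D, rfl⟩).2
    rw [macroTile_bondSite (by omega) D false h1 h2, macroTile_bondSite (by omega) D true h1 h2]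
    simp only [halfGlue]
    omega
  site_inj := fun D g u u' h => (bondSite_inj D h).2
  contact := fun t ht t' ht' p v d hp hp' hv h hs =>
    macroTile_contact (by omega) (by push_cast; rfl)
      (fun D => by exact_mod_cast hk _ ⟨t, ht, D, rfl⟩)
      (fun D => by exact_mod_cast hk _ ⟨t', ht', D, rfl⟩)
      (fun D D' h => hinj ⟨t, ht, D, rfl⟩ ⟨t', ht', D', rfl⟩ h) hp hp' hv h hs
  zero_mem := by
    change ((0 : ℤ), (0 : ℤ)) ∈ _
    rw [macroShape_square (by omega) (by omega) (by omega) (by omega)]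
    simp only [InComb]
    omega
  one_mem := by
    rw [macroShape_square (by omega) (by omega) (by omega) (by omega)]
    simp only [InComb]
    omega
  read := fun t ht t' ht' h => funext fun D => hinj ⟨t, ht, D, rfl⟩ ⟨t', ht', D, rfl⟩
    (eq_of_markLabel (a := a) (τ := τ)
      (fun D => by exact_mod_cast hk _ ⟨t, ht, D, rfl⟩) (by push_cast at h; exact h) D)
  origin := fun t t' p _ h => macroTile_origin (by omega) h
  exposed := fun t p d h => by
    rcases macroTile_outer (τ := τ) (k := k) (t := t) h with ⟨u, _, h⟩ | h
    · exact Or.inr (by rw [h, length_halfGlue])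
    · exact Or.inl (by rw [h])

/-! ### The universal tile set -/

instance : Fintype Dir :=
  ⟨⟨[Dir.north, Dir.east, Dir.south, Dir.west], by simp⟩, fun d => by cases d <;> simp⟩

open Classical in
/-- The glues inside a macrotile and the glue without strength. -/
noncomputable def baseGlues (τ : ℕ) : Finset Glue :=
  insert ⟨[], 0⟩ ((Finset.univ : Finset (Bool × Bool × Bool × Bool × Bool)).image fun b =>
    ⟨[b.1, b.2.1, b.2.2.1, b.2.2.2.1, b.2.2.2.2], (τ + 1) / 2⟩)

open Classical in
/-- The glues that realize bonds between macrotiles. -/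
noncomputable def bondGlues (τ : ℕ) : Finset Glue :=
  (Finset.range (τ + 1) ×ˢ (Finset.univ : Finset Bool)).image fun x => halfGlue x.1 x.2

open Classical in
/-- The tiles with base glues on all sides, except that one side may carry a bonding glue. -/
noncomputable def universalTiles (τ : ℕ) : Finset TileType :=
  ((Finset.univ : Finset Dir) ×ˢ (baseGlues τ ∪ bondGlues τ) ×ˢ
    Fintype.piFinset fun _ : Dir => baseGlues τ).image fun x => Function.update x.2.2 x.1 x.2.1

/-- There are at most 33 base glues, the 32 five-bit labels and the null glue. For `τ ≥ 2` at most
`33 + 2(τ + 1) ≤ 20τ` glues are possible on the special side, and `4 · 20 · 33⁴ < 10⁸`. -/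
theorem card_universalTiles {τ : ℕ} (hτ : 2 ≤ τ) : (universalTiles τ).card ≤ 100000000 * τ := by
  classical
  have h1 : (baseGlues τ).card ≤ 33 := by
    refine (Finset.card_insert_le _ _).trans ?_
    have : ((Finset.univ : Finset (Bool × Bool × Bool × Bool × Bool)).image fun b =>
      (⟨[b.1, b.2.1, b.2.2.1, b.2.2.2.1, b.2.2.2.2], (τ + 1) / 2⟩ : Glue)).card ≤ 32 :=
      Finset.card_image_le.trans (by simp)
    omega
  have h2 : (bondGlues τ).card ≤ (τ + 1) * 2 := Finset.card_image_le.trans (by simp)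
  have h3 : (baseGlues τ ∪ bondGlues τ).card ≤ 20 * τ :=
    (Finset.card_union_le _ _).trans (by omega)
  have h4 : Fintype.card Dir = 4 := rfl
  have h5 : (Fintype.piFinset fun _ : Dir => baseGlues τ).card ≤ 33 ^ 4 := by
    rw [Fintype.card_piFinset, Finset.prod_const, Finset.card_univ, h4]
    exact Nat.pow_le_pow_left h1 4
  calc (universalTiles τ).card ≤ 4 * ((baseGlues τ ∪ bondGlues τ).card *
        (Fintype.piFinset fun _ : Dir => baseGlues τ).card) := by
        refine Finset.card_image_le.trans ?_
        rw [Finset.card_product, Finset.card_product, Finset.card_univ, h4]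
    _ ≤ 4 * (20 * τ * 33 ^ 4) := Nat.mul_le_mul_left _ (Nat.mul_le_mul h3 h5)
    _ ≤ 100000000 * τ := by omega

theorem mem_baseGlues {τ : ℕ} {g : Glue} : g ∈ baseGlues τ ↔
    g = ⟨[], 0⟩ ∨ ∃ b₀ b₁ b₂ b₃ b₄, g = ⟨[b₀, b₁, b₂, b₃, b₄], (τ + 1) / 2⟩ := by
  simp only [baseGlues, Finset.mem_insert, Finset.mem_image, Finset.mem_univ, true_and,
    Prod.exists, eq_comm]

theorem mem_bondGlues {τ : ℕ} {g : Glue} :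
    g ∈ bondGlues τ ↔ ∃ s u, s ≤ τ ∧ g = halfGlue s u := by
  simp only [bondGlues, Finset.mem_image, Finset.mem_product, Finset.mem_range, Finset.mem_univ,
    and_true, Prod.exists, Nat.lt_succ_iff, eq_comm]

open Classical in
theorem mem_universalTiles {τ : ℕ} {u : TileType} : u ∈ universalTiles τ ↔
    ∃ (d₀ : Dir) (g : Glue) (f : TileType), (g ∈ baseGlues τ ∨ g ∈ bondGlues τ) ∧
      (∀ d, f d ∈ baseGlues τ) ∧ u = Function.update f d₀ g := by
  simp only [universalTiles, Finset.mem_image, Finset.mem_product, Finset.mem_univ, true_and,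
    Finset.mem_union, Fintype.mem_piFinset, Prod.exists, and_assoc, eq_comm]

/-- Since `τ ≥ 2`, both an inner glue and a half bond have strength at most `(τ + 1) / 2 < τ`. This
is the reason for splitting bonds into halves. -/
theorem inert_of_mem_universalTiles {τ : ℕ} (hτ : 2 ≤ τ) {u : TileType}
    (hu : u ∈ universalTiles τ) : Scheme.Inert τ u := by
  classical
  have hbase : ∀ g ∈ baseGlues τ, g.strength < τ ∧ (g.strength = 0 ∨ g.label.length ≠ 1) := by
    intro g hg
    rcases mem_baseGlues.1 hg with rfl | ⟨_, _, _, _, _, rfl⟩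
    · exact ⟨by dsimp only; omega, Or.inl rfl⟩
    · exact ⟨by dsimp only; omega, Or.inr (by simp)⟩
  have hbond : ∀ g ∈ bondGlues τ, g.strength < τ := by
    intro g hg
    obtain ⟨s, u, hs, rfl⟩ := mem_bondGlues.1 hg
    cases u <;> simp only [halfGlue] <;> omega
  obtain ⟨d₀, g, f, hg, hf, rfl⟩ := mem_universalTiles.1 hu
  refine ⟨fun d => ?_, d₀, fun d hd => ?_⟩
  · by_cases hd : d = d₀
    · subst hd
      rw [Function.update_self]
      rcases hg with hg | hg
      · exact (hbase g hg).1
      · exact hbond g hg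
    · rw [Function.update_of_ne hd]
      exact (hbase _ (hf d)).1
  · rw [Function.update_of_ne hd]
    exact (hbase _ (hf d)).2

/-- Bonding sites for different sides are at different positions by `bondSite_side`, so a tile has
at most one bonding glue. Otherwise the number of tiles would not be linear in `τ`. -/
theorem macroTile_mem_universalTiles {a : ℤ} {τ : ℕ} {k : Glue → ℕ × ℕ} {t : TileType}
    (hk : ∀ D, ((k (t D)).1 : ℤ) < a ∧ ((k (t D)).2 : ℤ) < a) (p : ℤ × ℤ) :
    macroTile a τ k t p ∈ universalTiles τ := by
  classical
  have hnull : (⟨[], 0⟩ : Glue) ∈ baseGlues τ := mem_baseGlues.2 (Or.inl rfl)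
  have hcases : ∀ d, macroTile a τ k t p d ∈ baseGlues τ ∨
      ∃ u, p = bondSite a d.turn (k (t d.turn)) u ∧
        macroTile a τ k t p d = halfGlue (min (t d.turn).strength τ) u := by
    intro d
    by_cases hd : p + d.vec ∈ macroShape a
    · rw [macroTile_inner hd, mem_baseGlues]
      refine Or.inl (Or.inr ?_)
      cases d <;> exact ⟨_, _, _, _, _, rfl⟩
    · rcases macroTile_outer (τ := τ) (k := k) (t := t) hd with h | h
      · exact Or.inr h
      · exact Or.inl (h ▸ hnull)
  obtain ⟨d₀, h₀⟩ : ∃ d₀, ∀ d, d ≠ d₀ → macroTile a τ k t p d ∈ baseGlues τ := by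
    by_cases h : ∃ (d : Dir) (u : Bool), p = bondSite a d.turn (k (t d.turn)) u
    · obtain ⟨d₀, u₀, h0⟩ := h
      refine ⟨d₀, fun d hd => (hcases d).resolve_right ?_⟩
      rintro ⟨u, h2, _⟩
      exact hd (Dir.turn_injective (bondSite_side (hk _).1 (hk _).2 (h2.symm.trans h0)))
    · exact ⟨.north, fun d _ => (hcases d).resolve_right fun ⟨u, h2, _⟩ => h ⟨d, u, h2⟩⟩
  refine mem_universalTiles.2 ⟨d₀, macroTile a τ k t p d₀,
    Function.update (macroTile a τ k t p) d₀ ⟨[], 0⟩, ?_, fun d => ?_, by simp⟩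
  · refine (hcases d₀).imp_right fun ⟨u, _, h⟩ => ?_
    exact mem_bondGlues.2 ⟨_, u, min_le_right _ _, h⟩
  · by_cases hd : d = d₀
    · subst hd
      rw [Function.update_self]
      exact hnull
    · rw [Function.update_of_ne hd]
      exact h₀ d hd

/-! ### The simulating system -/

theorem finite_glues (T : Finset TileType) : (glues T).Finite := by
  refine ((T.finite_toSet.prod (Set.finite_univ (α := Dir))).image fun x => x.1 x.2).subset ?_
  rintro _ ⟨t, ht, d, rfl⟩
  exact ⟨(t, d), ⟨ht, Set.mem_univ _⟩, rfl⟩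

theorem exists_index {s : Set Glue} (hs : s.Finite) {a : ℕ} (ha : s.ncard ≤ a * a) :
    ∃ k : Glue → ℕ × ℕ, (∀ g ∈ s, (k g).1 < a ∧ (k g).2 < a) ∧ Set.InjOn k s := by
  have hcard : s.encard ≤ (↑(Finset.range a ×ˢ Finset.range a) : Set (ℕ × ℕ)).encard := by
    rw [Set.encard_coe_eq_coe_finsetCard, ← hs.cast_ncard_eq]
    simpa using mod_cast ha
  obtain ⟨k, hk, hinj⟩ := hs.exists_injOn_of_encard_le hcard
  exact ⟨k, fun g hg => by simpa using hk hg, hinj⟩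

theorem singletonSupertiles_spec {U : Finset TileType} {τ : ℕ} :
    ∀ s ∈ singletonSupertiles U, ∃ α, s = supertile α ∧ IsOver U α ∧ (dom α).Nonempty ∧
      Stable τ α := by
  rintro _ ⟨t, ht, rfl⟩
  refine ⟨single t, rfl, fun p s h => ?_, ⟨(0, 0), mem_dom.2 ⟨t, if_pos rfl⟩⟩, ?_⟩
  · unfold single at h
    split_ifs at h
    exact Option.some.inj h ▸ ht
  · have hd : ∀ p ∈ dom (single t), p = (0, 0) := by
      intro p hp
      by_contra hc
      exact hp (if_neg hc)
    rintro X hX ⟨x, hx⟩ ⟨y, hy, hyX⟩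
    rw [hd x (hX hx)] at hx
    rw [hd y hy] at hyX
    exact absurd hx hyX

namespace Scheme

variable {T : System} (S : Scheme T.tiles T.temp)

/-- The expansions of the members of a supertile and their translates. -/
def expandSet (s : Set Assembly) : Set Assembly :=
  {β | ∃ α ∈ s, ∃ u, β = translateBy u (S.expand α)}

theorem expandSet_supertile (α : Assembly) :
    S.expandSet (supertile α) = supertile (S.expand α) := by
  ext β
  constructor
  · rintro ⟨_, ⟨w, rfl⟩, u, rfl⟩
    exact ⟨u + (S.m : ℤ) • w, by rw [expand_translateBy, translateBy_translateBy]⟩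
  · rintro ⟨u, rfl⟩
    exact ⟨α, self_mem_supertile α, u, rfl⟩

/-- Decoding recovers the initial supertile from its expansion; hence there are as many expanded
initial supertiles as original ones. -/
theorem expandSet_injOn : Set.InjOn S.expandSet T.init := by
  intro s hs s' hs' h
  obtain ⟨α, rfl, h1, h2, _⟩ := T.init_spec s hs
  obtain ⟨β, rfl, h3, h4, _⟩ := T.init_spec s' hs'
  rw [expandSet_supertile, expandSet_supertile] at h
  rw [← repSupertile_expand (S := S) h1 h2, h, repSupertile_expand h3 h4]

/-- The system that simulates `T` with single tiles from `U` and the macrotiles of a scheme. -/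
def hostSystem (U : Finset TileType) (hU : ∀ t ∈ T.tiles, ∀ p ∈ S.P, S.M t p ∈ U) : System where
  tiles := U
  init := singletonSupertiles U ∪ S.expandSet '' T.init
  temp := T.temp
  init_spec := by
    rintro s (hs | ⟨s, hs, rfl⟩)
    · exact singletonSupertiles_spec s hs
    · obtain ⟨α, rfl, h1, h2, h3⟩ := T.init_spec s hs
      refine ⟨S.expand α, expandSet_supertile S α, fun p u h => ?_, S.expand_nonempty.2 h2,
        stable_expand h1 h3⟩
      obtain ⟨q, t, h4, h5, rfl⟩ := S.expand_some.1 h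
      exact hU t (h1 _ _ h4) _ h5

theorem hosts_hostSystem (hpos : 0 < T.temp) {U : Finset TileType}
    (hU : ∀ t ∈ T.tiles, ∀ p ∈ S.P, S.M t p ∈ U) (hinert : ∀ u ∈ U, Inert T.temp u) :
    Hosts S (S.hostSystem U hU) where
  temp := rfl
  pos := hpos
  init := by
    intro s
    refine or_congr Iff.rfl ⟨?_, ?_⟩
    · rintro ⟨s, hs, rfl⟩
      obtain ⟨α, rfl, _⟩ := T.init_spec s hs
      exact ⟨α, hs, expandSet_supertile S α⟩
    · rintro ⟨α, hα, rfl⟩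
      exact ⟨_, hα, expandSet_supertile S α⟩
  inert := hinert

theorem finiteSupertile_expandSet {s : Set Assembly} (hs : FiniteSupertile s) :
    FiniteSupertile (S.expandSet s) := by
  rintro _ ⟨α, hα, u, rfl⟩
  refine ((S.expand_finite (hs α hα)).image (· + u)).subset fun p hp => ⟨p - u, hp, ?_⟩
  simp

end Scheme

/-- The side is `O(1 + √g)`. The logarithm is at least 1 for `g ≥ 3`, and smaller `g` are absorbed
by the additive constant. -/
theorem scale_le (g : ℕ) : ((12 * (Nat.sqrt g + 2) : ℕ) : ℝ) ≤
    100000000 * (1 + Real.sqrt ((g : ℝ) * Real.log (g : ℝ))) := by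
  have h0 : 0 ≤ Real.sqrt ((g : ℝ) * Real.log (g : ℝ)) := Real.sqrt_nonneg _
  have h1 : (Nat.sqrt g : ℝ) ≤ 2 + Real.sqrt ((g : ℝ) * Real.log (g : ℝ)) := by
    by_cases hg : g < 3
    · have : Nat.sqrt g ≤ 2 := (Nat.sqrt_le_self g).trans (by omega)
      have : (Nat.sqrt g : ℝ) ≤ 2 := by exact_mod_cast this
      linarith
    · have hg3 : (3 : ℝ) ≤ g := by exact_mod_cast not_lt.1 hg
      have hlog : 1 ≤ Real.log (g : ℝ) := by
        rw [Real.le_log_iff_exp_le (by linarith)]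
        exact Real.exp_one_lt_d9.le.trans (by linarith)
      have h2 : (Nat.sqrt g : ℝ) ≤ Real.sqrt (g : ℝ) := Real.nat_sqrt_le_real_sqrt
      have h3 : Real.sqrt (g : ℝ) ≤ Real.sqrt ((g : ℝ) * Real.log (g : ℝ)) :=
        Real.sqrt_le_sqrt (by nlinarith)
      linarith
  push_cast
  linarith

end TwoHAM

/-! ### The main theorem: choice of the parameters -/

theorem mainTheorem8 :
    ∃ C : ℝ, 0 < C ∧ ∀ τ : ℕ, 2 ≤ τ →
      ∃ U : Finset TwoHAM.TileType, (U.card : ℝ) ≤ C * (τ : ℝ) ∧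
        ∀ T : TwoHAM.System, T.temp = τ →
          ∃ (I : Set (Set TwoHAM.Assembly)) (UT : TwoHAM.System) (m : ℕ),
            Cardinal.mk I = Cardinal.mk T.init ∧
            ((∀ s ∈ T.init, TwoHAM.FiniteSupertile s) → ∀ s ∈ I, TwoHAM.FiniteSupertile s) ∧
            UT.tiles = U ∧
            UT.init = TwoHAM.singletonSupertiles U ∪ I ∧
            UT.temp = τ ∧
            (m : ℝ) ≤ C * (1 + Real.sqrt (((TwoHAM.glues T.tiles).ncard : ℝ) *
              Real.log ((TwoHAM.glues T.tiles).ncard : ℝ))) ∧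
            TwoHAM.StronglySimulates UT T m := by
  refine ⟨100000000, by norm_num, fun τ hτ => ⟨TwoHAM.universalTiles τ, ?_, ?_⟩⟩
  · exact_mod_cast TwoHAM.card_universalTiles hτ
  rintro T rfl
  -- With `a = ⌊√|G|⌋ + 2` there are at least `|G|` index pairs, and `a ≥ 2` as the shape requires.
  have hg : (TwoHAM.glues T.tiles).ncard ≤
      (Nat.sqrt (TwoHAM.glues T.tiles).ncard + 2) * (Nat.sqrt (TwoHAM.glues T.tiles).ncard + 2) := by
    have := Nat.lt_succ_sqrt (TwoHAM.glues T.tiles).ncard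
    simp only [Nat.succ_eq_add_one] at this
    nlinarith
  obtain ⟨k, hk, hinj⟩ := TwoHAM.exists_index (TwoHAM.finite_glues T.tiles) hg
  let S := TwoHAM.gridScheme T.tiles T.temp _ k (by omega) hk hinj
  have hU : ∀ t ∈ T.tiles, ∀ p ∈ S.P, S.M t p ∈ TwoHAM.universalTiles T.temp := fun t ht p _ =>
    TwoHAM.macroTile_mem_universalTiles
      (fun D => by exact_mod_cast hk _ ⟨t, ht, D, rfl⟩) p
  refine ⟨S.expandSet '' T.init, S.hostSystem _ hU, S.m,
    Cardinal.mk_image_eq_of_injOn _ _ S.expandSet_injOn, ?_, rfl, rfl, rfl,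
    TwoHAM.scale_le _, TwoHAM.Scheme.stronglySimulates (S.hosts_hostSystem (by omega) hU fun u hu =>
      TwoHAM.inert_of_mem_universalTiles hτ hu)⟩
  rintro hfin _ ⟨s, hs, rfl⟩
  exact S.finiteSupertile_expandSet (hfin s hs)
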